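/- Let $T_j=j(j+1)/2$, $(q)_N=\prod_{j=1}^{N}(1-q^j)$, and for integers $N,n$ let ${N\brack n}=\frac{(q)_N}{(q)_n(q)_{N-n}}$ if $n\ge 0$ and $N-n\ge 0$, and ${N\brack n}=0$ otherwise. Let $A,B,C,q$ be elements of a field, where $q^n\ne 1$ for all $n\ge 1$ (for example, indeterminates). For a partition $\tilde\pi$ into distinct positive parts, a chain of $\tilde\pi$ is a maximal run of consecutive integers among its parts. A chain $\chi$ with $l$ parts and least part $s(\chi)$ has the weight $$\omega(\chi)=\begin{cases}\displaystyle\sum_{i+j+k=l}A^iB^jC^k+ABC\sum_{i+j+k=l-2}A^iB^jC^k,& s(\chi)=1,\\[2mm] F_l+A(B+C)F_{l-1}+A^2BC\,F_{l-2},& s(\chi)>1,\end{cases}$$ where $$F_l=\sum_{i+j+k=l}A^iB^jC^k+ABC\sum_{i+j+k=l-2}A^iB^jC^k+BC\sum_{j+k=l-1}B^jC^k,$$ all summation variables being $\ge 0$, so that a sum over an empty index set is $0$. Put $\omega(\tilde\pi)=\prod_\chi\omega(\chi)$, the product over all chains $\chi$ of $\tilde\pi$. A Type-1 colouring of $\tilde\pi$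 assigns to each part one of six colours, ordered $\mathbf{AB}<\mathbf{AC}<\mathbf{A}<\mathbf{BC}<\mathbf{B}<\mathbf{C}$, of which $\mathbf A,\mathbf B,\mathbf C$ are called primary, such that a part equal to $1$ has a primary colour, and whenever two parts differ by $1$, either both have the same primary colour or the larger part has a colour of higher order. A part in colour $\mathbf A,\mathbf B,\mathbf C,\mathbf{AB},\mathbf{AC},\mathbf{BC}$ is counted with weight $A,B,C,AB,AC,BC$, respectively. Let $L\ge 0$ be an integer, and let $D_L$ be the set of all partitions into distinct parts $\le L$ (including the empty partition). Then: (i) for every $\tilde\pi\in D_L$, $\omega(\tilde\pi)$ is the sum, over all Type-1 colourings of $\tilde\pi$, of the product of the weights of the coloured parts; (ii) with $|\tilde\pi|$ denoting the sum of the parts of $\tilde\pi$, $$\sum_{\tilde\pi\in D_L}\omega(\tilde\pi)\,q^{|\tilde\pi|}=\sum_{i,j,k\ge 0}q^{T_i+T_j+T_k}A^iB^jC^k{L-i\brack j}{L-j\brack k}{L-k\brack i}.$$ -/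

import Mathlib

open Finset

noncomputable section

namespace Goellnitz

/-! ### Gaussian binomial coefficients -/

/-- `(q)_N = (q;q)_N = (1 - q)(1 - q^2)⋯(1 - q^N)`. -/
def qPoch {K : Type*} [Field K] (q : K) (N : ℕ) : K :=
  ∏ j ∈ range N, (1 - q ^ (j + 1))

/-- The `q`-binomial coefficient with upper entry `N` and lower entry `n`, both integers:
`(q)_N / ((q)_n (q)_{N-n})` if `n ≥ 0` and `N - n ≥ 0`, and `0` otherwise. -/
def qBinom {K : Type*} [Field K] (q : K) (N n : ℤ) : K :=
  if 0 ≤ n ∧ 0 ≤ N - n then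
    qPoch q N.toNat / (qPoch q n.toNat * qPoch q (N - n).toNat)
  else 0

/-- The triangular number `T_j = j (j + 1) / 2`. -/
def T (j : ℕ) : ℕ := j * (j + 1) / 2

/-- The summand `q^{T_i+T_j+T_k} A^i B^j C^k [L-i, j] [L-j, k] [L-k, i]`. -/
def rhsTerm {K : Type*} [Field K] (q A B C : K) (L i j k : ℕ) : K :=
  q ^ (T i + T j + T k) * A ^ i * B ^ j * C ^ k *
    qBinom q ((L : ℤ) - i) j * qBinom q ((L : ℤ) - j) k * qBinom q ((L : ℤ) - k) i

/-- The summand vanishes as soon as one of the indices exceeds `L`, so that the sum over all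
`i, j, k ≥ 0` is the sum over `0 ≤ i, j, k ≤ L`. -/
theorem rhsTerm_eq_zero {K : Type*} [Field K] (q A B C : K) (L i j k : ℕ)
    (h : L < i ∨ L < j ∨ L < k) : rhsTerm q A B C L i j k = 0 := by
  unfold rhsTerm qBinom
  rcases h with h | h | h
  · rw [if_neg (show ¬((0 : ℤ) ≤ j ∧ 0 ≤ (L : ℤ) - i - j) by omega)]; simp
  · rw [if_neg (show ¬((0 : ℤ) ≤ k ∧ 0 ≤ (L : ℤ) - j - k) by omega)]; simp
  · rw [if_neg (show ¬((0 : ℤ) ≤ i ∧ 0 ≤ (L : ℤ) - k - i) by omega)]; simp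

/-! ### Partitions into distinct parts and their chains -/

/-- The partitions into distinct parts `≤ L`, a partition being given by its set of parts. -/
def distinctParts (L : ℕ) : Finset (Finset ℕ) := (Icc 1 L).powerset

/-- A (nonempty) run of consecutive integers. -/
def IsRun (χ : Finset ℕ) : Prop := ∃ s t : ℕ, s ≤ t ∧ χ = Icc s t

open Classical in
/-- The chains of `π`: the maximal runs of consecutive integers in `π`. -/
def chains (π : Finset ℕ) : Finset (Finset ℕ) :=
  π.powerset.filter (fun χ => Maximal (fun ρ => ρ ⊆ π ∧ IsRun ρ) χ)

/-! ### The explicit chain weights -/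

/-- `∑_{i+j+k=n} A^i B^j C^k` over `i, j, k ≥ 0` (zero for negative `n`). -/
def h3 {R : Type*} [CommRing R] (A B C : R) (n : ℤ) : R :=
  ∑ i ∈ range (n.toNat + 1), ∑ j ∈ range (n.toNat + 1), ∑ k ∈ range (n.toNat + 1),
    if (i : ℤ) + j + k = n then A ^ i * B ^ j * C ^ k else 0

/-- `∑_{j+k=n} B^j C^k` over `j, k ≥ 0` (zero for negative `n`). -/
def h2 {R : Type*} [CommRing R] (B C : R) (n : ℤ) : R :=
  ∑ j ∈ range (n.toNat + 1), ∑ k ∈ range (n.toNat + 1),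
    if (j : ℤ) + k = n then B ^ j * C ^ k else 0

/-- `F_l = ∑_{i+j+k=l} A^i B^j C^k + ABC ∑_{i+j+k=l-2} A^i B^j C^k + BC ∑_{j+k=l-1} B^j C^k`. -/
def F {R : Type*} [CommRing R] (A B C : R) (l : ℤ) : R :=
  h3 A B C l + A * B * C * h3 A B C (l - 2) + B * C * h2 B C (l - 1)

/-- The weight of a chain `χ`; it depends on the length `l = #χ` and on whether the least part
of `χ` is `1`. -/
def chainWeight {R : Type*} [CommRing R] (A B C : R) (χ : Finset ℕ) : R :=
  let l : ℤ := (#χ : ℤ)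
  if χ.min = ((1 : ℕ) : WithTop ℕ) then
    h3 A B C l + A * B * C * h3 A B C (l - 2)
  else
    F A B C l + A * (B + C) * F A B C (l - 1) + A ^ 2 * B * C * F A B C (l - 2)

/-- The weight of a partition into distinct parts: the product of the weights of its chains. -/
def weight {R : Type*} [CommRing R] (A B C : R) (π : Finset ℕ) : R :=
  ∏ χ ∈ chains π, chainWeight A B C χ

/-! ### Type-1 colourings -/

/-- The three primary colours `A, B, C` and the three secondary colours `AB, AC, BC`. -/
inductive Colour
  | AB | AC | A | BC | B | C
  deriving DecidableEq

instance : Fintype Colour where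
  elems := {.AB, .AC, .A, .BC, .B, .C}
  complete := by intro X; cases X <;> decide

/-- The position of a colour in the order `AB < AC < A < BC < B < C`. -/
def Colour.rank : Colour → ℕ
  | .AB => 0 | .AC => 1 | .A => 2 | .BC => 3 | .B => 4 | .C => 5

/-- The primary colours are `A, B, C`. -/
def Colour.IsPrimary (X : Colour) : Prop := X = .A ∨ X = .B ∨ X = .C

/-- A part in colour `X` is counted with the weight `X`, where `AB = A * B` and so on. -/
def Colour.wt {R : Type*} [CommRing R] (A B C : R) : Colour → R
  | .AB => A * B | .AC => A * C | .A => A | .BC => B * C | .B => B | .C => C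

/-- The colourings of the parts of `π` that make `π` a Type-1 partition: a part `1` is in a
primary colour, and where two parts differ by `1`, they are of the same primary colour or the
larger one is in a colour of higher order. -/
def IsType1 (π : Finset ℕ) (c : π → Colour) : Prop :=
  (∀ x : π, (x : ℕ) = 1 → (c x).IsPrimary) ∧
  ∀ x y : π, (y : ℕ) = x + 1 →
    (c x = c y ∧ (c x).IsPrimary) ∨ (c x).rank < (c y).rank

open Classical in
/-- The sum, over all Type-1 colourings of `π`, of the product of the weights of the coloured
parts. -/
def colourSum {R : Type*} [CommRing R] (A B C : R) (π : Finset ℕ) : R :=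
  ∑ c : π → Colour with IsType1 π c, ∏ x : π, (c x).wt A B C

end Goellnitz

end

/-! Along a chain of a Type-1 partition the colours weakly increase upwards; a primary colour may
repeat, a secondary one occurs at most once, and different chains do not interact. With `x` marking
length, chains not starting at 1 are therefore counted by (1+ABx)(1+ACx)(1+BCx) /
((1-Ax)(1-Bx)(1-Cx)). If the chain starts at 1, its lowest colour is primary: this excludes AB and
AC and allows BC only above an A, so the numerator becomes 1+ABCx². Expanding gives the two chain
weights (`runSum_of_pos`, `runSum_zero_left`), and peeling off the topmost chain proves (i)
(`weight_eq_colourSum`).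

By (i) the left side of (ii) is the generating function of Type-1 partitions into parts ≤ L. The
colours allowed directly below a given one form an initial segment of the order, so removing the
largest part gives a linear system for the generating functions with bounded top colour
(`genFun_succ`). Eliminating the bounded ones leaves a recurrence in L that reaches back to L-4
(`genFun_recurrence`).

The q-binomial sum obeys the same recurrence (`rhsSum_recurrence`). This is checked coefficient by
coefficient: after removal of a common factor it is a rational identity in q, q^L, q^i, q^j, q^k,
except near the boundary of the support, where finitely many shapes of index are treated separately
(`coeffDefect_eq_zero`). Both sides agree at L = 0, 1, 2 and are taken as 0 at L = -1. The argument
divides by powers of q, so q = 0 is treated on its own. -/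

open Finset

noncomputable section

namespace Goellnitz

/-! ### The q-binomial side: its coefficients and their recurrence in L -/

section Coefficients

variable {K : Type*} [Field K]

/-- `(q)_n`, extended by `1` to negative `n`. -/
def qPochInt (q : K) (n : ℤ) : K := qPoch q n.toNat

/-- `1 / (q)_n`, extended by `0` to negative `n`. -/
def qPochInv (q : K) (n : ℤ) : K := if 0 ≤ n then (qPoch q n.toNat)⁻¹ else 0

/-- `T_n` for integers `n`. -/
def TInt (n : ℤ) : ℤ := n * (n + 1) / 2

/-- The coefficient of `A^i B^j C^k` on the `q`-binomial side, in its symmetric form. -/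
def coeff (q : K) (L i j k : ℤ) : K :=
  q ^ (TInt i + TInt j + TInt k) *
    (qPochInt q (L - i) * qPochInt q (L - j) * qPochInt q (L - k)) *
    (qPochInv q i * qPochInv q j * qPochInv q k *
      (qPochInv q (L - i - j) * qPochInv q (L - j - k) * qPochInv q (L - k - i)))

theorem coeff_rotate (q : K) (L i j k : ℤ) : coeff q L i j k = coeff q L j k i := by
  unfold coeff
  rw [show TInt i + TInt j + TInt k = TInt j + TInt k + TInt i by ring]
  ring

theorem qPochInt_step (q : K) {n : ℤ} (hn : 1 ≤ n) :
    qPochInt q n = (1 - q ^ n) * qPochInt q (n - 1) := by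
  obtain ⟨m, rfl⟩ : ∃ m : ℕ, n = m + 1 := ⟨(n - 1).toNat, by omega⟩
  have h1 : ((m : ℤ) + 1).toNat = m + 1 := by omega
  have h2 : ((m : ℤ) + 1 - 1).toNat = m := by omega
  rw [qPochInt, qPochInt, h1, h2, qPoch, prod_range_succ, ← qPoch]
  have : q ^ ((m : ℤ) + 1) = q ^ (m + 1) := by exact_mod_cast zpow_natCast q (m + 1)
  rw [this]; ring

theorem qPochInv_of_neg (q : K) {n : ℤ} (hn : n < 0) : qPochInv q n = 0 :=
  if_neg (by omega)

/-- No sign condition on n is needed, since at n = 0 the factor 1 - q^0 vanishes together with the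
left side. By contrast `qPochInt_step` fails for n = 0; this asymmetry is what creates the edge
cases below. -/
theorem qPochInv_step {q : K} (hq : ∀ n : ℕ, 0 < n → q ^ n ≠ 1) (n : ℤ) :
    qPochInv q (n - 1) = (1 - q ^ n) * qPochInv q n := by
  rcases lt_trichotomy n 0 with h | rfl | h
  · rw [qPochInv_of_neg q h, qPochInv_of_neg q (by omega), mul_zero]
  · rw [qPochInv_of_neg q (by omega)]; simp
  · obtain ⟨m, rfl⟩ : ∃ m : ℕ, n = m + 1 := ⟨(n - 1).toNat, by omega⟩
    have h1 : ((m : ℤ) + 1).toNat = m + 1 := by omega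
    have h2 : ((m : ℤ) + 1 - 1).toNat = m := by omega
    have h3 : q ^ ((m : ℤ) + 1) = q ^ (m + 1) := by exact_mod_cast zpow_natCast q (m + 1)
    rw [qPochInv, qPochInv, if_pos (by omega), if_pos (by omega), h1, h2, h3]
    conv_rhs => rw [qPoch, prod_range_succ, ← qPoch]
    have h4 : (1 - q ^ (m + 1)) ≠ 0 := sub_ne_zero.2 (hq (m + 1) (by omega)).symm
    rw [mul_inv, mul_comm, mul_assoc, inv_mul_cancel₀ h4, mul_one]

theorem TInt_step (n : ℤ) : TInt (n - 1) = TInt n - n := by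
  unfold TInt
  have : n * (n + 1) = (n - 1) * (n - 1 + 1) + n * 2 := by ring
  rw [this, Int.add_mul_ediv_right _ _ (by norm_num)]; ring

theorem TInt_natCast (n : ℕ) : TInt n = (T n : ℤ) := by
  unfold TInt T; push_cast; rfl

/-- The recurrence in `L`, as an expression in the coefficients that has to vanish. -/
def coeffDefect (q : K) (L i j k : ℤ) : K :=
  coeff q L i j k - coeff q (L - 1) i j k
    - q ^ L * (coeff q (L - 1) (i - 1) j k + coeff q (L - 1) i (j - 1) k
        + coeff q (L - 1) i j (k - 1))
    - q ^ L * (1 - q ^ (L - 1)) * (coeff q (L - 2) (i - 1) (j - 1) k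
        + coeff q (L - 2) (i - 1) j (k - 1) + coeff q (L - 2) i (j - 1) (k - 1))
    - q ^ (3 * L - 3) * coeff q (L - 3) (i - 1) (j - 1) (k - 1)
    - q ^ (2 * L - 1) * (coeff q (L - 3) (i - 2) (j - 1) (k - 1)
        + coeff q (L - 3) (i - 1) (j - 2) (k - 1) + coeff q (L - 3) (i - 1) (j - 1) (k - 2))
    - q ^ (3 * L - 3) * coeff q (L - 4) (i - 2) (j - 2) (k - 2)

theorem coeffDefect_rotate (q : K) (L i j k : ℤ) :
    coeffDefect q L i j k = coeffDefect q L j k i := by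
  unfold coeffDefect
  simp only [coeff_rotate q _ i, coeff_rotate q _ (i - 1), coeff_rotate q _ (i - 2)]
  ring

variable {q : K}

/-- This and the five lemmas after it write every kind of term of the recurrence over one common
factor. Reciprocals can be stepped down freely, so they become explicit factors; the numerators
`qPochInt` are left untouched, because their step may fail. -/
theorem coeff_shift0 (hq : ∀ n : ℕ, 0 < n → q ^ n ≠ 1) (L i j k : ℤ) :
    coeff q (L - 1) i j k = q ^ (TInt i + TInt j + TInt k) *
      (qPochInt q (L - i - 1) * qPochInt q (L - j - 1) * qPochInt q (L - k - 1)) *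
      ((1 - q ^ (L - i - j)) * (1 - q ^ (L - j - k)) * (1 - q ^ (L - k - i))) *
      (qPochInv q i * qPochInv q j * qPochInv q k *
      (qPochInv q (L - i - j) * qPochInv q (L - j - k) * qPochInv q (L - k - i))) := by
  unfold coeff
  rw [show L - 1 - i - j = L - i - j - 1 by ring, show L - 1 - j - k = L - j - k - 1 by ring,
    show L - 1 - k - i = L - k - i - 1 by ring, show L - 1 - i = L - i - 1 by ring,
    show L - 1 - j = L - j - 1 by ring, show L - 1 - k = L - k - 1 by ring]
  simp only [qPochInv_step hq]
  ring

theorem coeff_shift1 (h0 : q ≠ 0) (hq : ∀ n : ℕ, 0 < n → q ^ n ≠ 1) (L i j k : ℤ) :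
    coeff q (L - 1) (i - 1) j k = q ^ (TInt i + TInt j + TInt k) / q ^ i *
      (qPochInt q (L - i) * qPochInt q (L - j - 1) * qPochInt q (L - k - 1)) *
      ((1 - q ^ i) * (1 - q ^ (L - j - k))) *
      (qPochInv q i * qPochInv q j * qPochInv q k *
      (qPochInv q (L - i - j) * qPochInv q (L - j - k) * qPochInv q (L - k - i))) := by
  unfold coeff
  rw [show L - 1 - (i - 1) - j = L - i - j by ring, show L - 1 - j - k = L - j - k - 1 by ring,
    show L - 1 - k - (i - 1) = L - k - i by ring, show L - 1 - (i - 1) = L - i by ring,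
    show L - 1 - j = L - j - 1 by ring, show L - 1 - k = L - k - 1 by ring, TInt_step,
    show TInt i - i + TInt j + TInt k = TInt i + TInt j + TInt k - i by ring, zpow_sub₀ h0]
  simp only [qPochInv_step hq]
  ring

theorem coeff_shift2 (h0 : q ≠ 0) (hq : ∀ n : ℕ, 0 < n → q ^ n ≠ 1) (L i j k : ℤ) :
    coeff q (L - 2) (i - 1) (j - 1) k = q ^ (TInt i + TInt j + TInt k) / q ^ i / q ^ j *
      (qPochInt q (L - i - 1) * qPochInt q (L - j - 1) * qPochInt q (L - k - 1 - 1)) *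
      ((1 - q ^ i) * (1 - q ^ j) * (1 - q ^ (L - j - k)) * (1 - q ^ (L - k - i))) *
      (qPochInv q i * qPochInv q j * qPochInv q k *
      (qPochInv q (L - i - j) * qPochInv q (L - j - k) * qPochInv q (L - k - i))) := by
  unfold coeff
  rw [show L - 2 - (i - 1) - (j - 1) = L - i - j by ring,
    show L - 2 - (j - 1) - k = L - j - k - 1 by ring,
    show L - 2 - k - (i - 1) = L - k - i - 1 by ring, show L - 2 - (i - 1) = L - i - 1 by ring,
    show L - 2 - (j - 1) = L - j - 1 by ring, show L - 2 - k = L - k - 1 - 1 by ring,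
    TInt_step, TInt_step,
    show TInt i - i + (TInt j - j) + TInt k = TInt i + TInt j + TInt k - i - j by ring,
    zpow_sub₀ h0, zpow_sub₀ h0]
  simp only [qPochInv_step hq]
  ring

theorem coeff_shift3 (h0 : q ≠ 0) (hq : ∀ n : ℕ, 0 < n → q ^ n ≠ 1) (L i j k : ℤ) :
    coeff q (L - 3) (i - 1) (j - 1) (k - 1) =
      q ^ (TInt i + TInt j + TInt k) / q ^ i / q ^ j / q ^ k *
      (qPochInt q (L - i - 1 - 1) * qPochInt q (L - j - 1 - 1) * qPochInt q (L - k - 1 - 1)) *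
      ((1 - q ^ i) * (1 - q ^ j) * (1 - q ^ k) *
        ((1 - q ^ (L - i - j)) * (1 - q ^ (L - j - k)) * (1 - q ^ (L - k - i)))) *
      (qPochInv q i * qPochInv q j * qPochInv q k *
      (qPochInv q (L - i - j) * qPochInv q (L - j - k) * qPochInv q (L - k - i))) := by
  unfold coeff
  rw [show L - 3 - (i - 1) - (j - 1) = L - i - j - 1 by ring,
    show L - 3 - (j - 1) - (k - 1) = L - j - k - 1 by ring,
    show L - 3 - (k - 1) - (i - 1) = L - k - i - 1 by ring,
    show L - 3 - (i - 1) = L - i - 1 - 1 by ring,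
    show L - 3 - (j - 1) = L - j - 1 - 1 by ring, show L - 3 - (k - 1) = L - k - 1 - 1 by ring,
    TInt_step, TInt_step, TInt_step,
    show TInt i - i + (TInt j - j) + (TInt k - k) = TInt i + TInt j + TInt k - i - j - k by ring,
    zpow_sub₀ h0, zpow_sub₀ h0, zpow_sub₀ h0]
  simp only [qPochInv_step hq]
  ring

theorem coeff_shift4 (h0 : q ≠ 0) (hq : ∀ n : ℕ, 0 < n → q ^ n ≠ 1) (L i j k : ℤ) :
    coeff q (L - 3) (i - 2) (j - 1) (k - 1) =
      q ^ (TInt i + TInt j + TInt k) / q ^ i / (q ^ i / q) / q ^ j / q ^ k *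
      (qPochInt q (L - i - 1) * qPochInt q (L - j - 1 - 1) * qPochInt q (L - k - 1 - 1)) *
      ((1 - q ^ i) * (1 - q ^ i / q) * (1 - q ^ j) * (1 - q ^ k) * (1 - q ^ (L - j - k))) *
      (qPochInv q i * qPochInv q j * qPochInv q k *
      (qPochInv q (L - i - j) * qPochInv q (L - j - k) * qPochInv q (L - k - i))) := by
  unfold coeff
  rw [show L - 3 - (i - 2) - (j - 1) = L - i - j by ring,
    show L - 3 - (j - 1) - (k - 1) = L - j - k - 1 by ring,
    show L - 3 - (k - 1) - (i - 2) = L - k - i by ring,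
    show L - 3 - (i - 2) = L - i - 1 by ring,
    show L - 3 - (j - 1) = L - j - 1 - 1 by ring, show L - 3 - (k - 1) = L - k - 1 - 1 by ring,
    show i - 2 = i - 1 - 1 by ring,
    TInt_step (i - 1), TInt_step, TInt_step, TInt_step,
    show TInt i - i - (i - 1) + (TInt j - j) + (TInt k - k) =
      TInt i + TInt j + TInt k - i - (i - 1) - j - k by ring,
    zpow_sub₀ h0, zpow_sub₀ h0, zpow_sub₀ h0, zpow_sub₀ h0, zpow_sub₀ h0, zpow_one]
  simp only [qPochInv_step hq, zpow_sub₀ h0, zpow_one]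
  ring

theorem coeff_shift5 (h0 : q ≠ 0) (hq : ∀ n : ℕ, 0 < n → q ^ n ≠ 1) (L i j k : ℤ) :
    coeff q (L - 4) (i - 2) (j - 2) (k - 2) =
      q ^ (TInt i + TInt j + TInt k) / q ^ i / (q ^ i / q) / q ^ j / (q ^ j / q) /
        q ^ k / (q ^ k / q) *
      (qPochInt q (L - i - 1 - 1) * qPochInt q (L - j - 1 - 1) * qPochInt q (L - k - 1 - 1)) *
      ((1 - q ^ i) * (1 - q ^ i / q) * (1 - q ^ j) * (1 - q ^ j / q) *
        (1 - q ^ k) * (1 - q ^ k / q)) *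
      (qPochInv q i * qPochInv q j * qPochInv q k *
      (qPochInv q (L - i - j) * qPochInv q (L - j - k) * qPochInv q (L - k - i))) := by
  unfold coeff
  rw [show L - 4 - (i - 2) - (j - 2) = L - i - j by ring,
    show L - 4 - (j - 2) - (k - 2) = L - j - k by ring,
    show L - 4 - (k - 2) - (i - 2) = L - k - i by ring,
    show L - 4 - (i - 2) = L - i - 1 - 1 by ring,
    show L - 4 - (j - 2) = L - j - 1 - 1 by ring, show L - 4 - (k - 2) = L - k - 1 - 1 by ring,
    show i - 2 = i - 1 - 1 by ring, show j - 2 = j - 1 - 1 by ring,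
    show k - 2 = k - 1 - 1 by ring,
    TInt_step (i - 1), TInt_step, TInt_step (j - 1), TInt_step, TInt_step (k - 1), TInt_step,
    show TInt i - i - (i - 1) + (TInt j - j - (j - 1)) + (TInt k - k - (k - 1)) =
      TInt i + TInt j + TInt k - i - (i - 1) - j - (j - 1) - k - (k - 1) by ring]
  simp only [qPochInv_step hq, zpow_sub₀ h0, zpow_one]
  ring

/-- The defect, divided by the common factor: `p₀, p₁, p₂` stand for
`(q)_{L-i}, (q)_{L-i-1}, (q)_{L-i-2}`, likewise `r` for `j` and `s` for `k`. -/
def defectCore (q x a b c p₀ p₁ p₂ r₀ r₁ r₂ s₀ s₁ s₂ : K) : K :=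
  p₀ * r₀ * s₀ - p₁ * r₁ * s₁ * ((1 - x / a / b) * (1 - x / b / c) * (1 - x / c / a))
    - x * (p₀ * r₁ * s₁ * ((1 - a) * (1 - x / b / c)) / a
      + p₁ * r₀ * s₁ * ((1 - b) * (1 - x / c / a)) / b
      + p₁ * r₁ * s₀ * ((1 - c) * (1 - x / a / b)) / c)
    - x * (1 - x / q) * (
        p₁ * r₁ * s₂ * ((1 - a) * (1 - b) * (1 - x / b / c) * (1 - x / c / a)) / (a * b)
      + p₁ * r₂ * s₁ * ((1 - c) * (1 - a) * (1 - x / a / b) * (1 - x / b / c)) / (a * c)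
      + p₂ * r₁ * s₁ * ((1 - b) * (1 - c) * (1 - x / c / a) * (1 - x / a / b)) / (b * c))
    - x ^ 3 / q ^ 3 * (p₂ * r₂ * s₂ * ((1 - a) * (1 - b) * (1 - c) *
        ((1 - x / a / b) * (1 - x / b / c) * (1 - x / c / a))) / (a * b * c))
    - x ^ 2 / q * (
        p₁ * r₂ * s₂ * ((1 - a) * (1 - a / q) * (1 - b) * (1 - c) * (1 - x / b / c))
          / (a * (a / q) * b * c)
      + p₂ * r₁ * s₂ * ((1 - b) * (1 - b / q) * (1 - c) * (1 - a) * (1 - x / c / a))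
          / (b * (b / q) * c * a)
      + p₂ * r₂ * s₁ * ((1 - c) * (1 - c / q) * (1 - a) * (1 - b) * (1 - x / a / b))
          / (c * (c / q) * a * b))
    - x ^ 3 / q ^ 3 * (p₂ * r₂ * s₂ * ((1 - a) * (1 - a / q) * (1 - b) * (1 - b / q) *
        (1 - c) * (1 - c / q)) / (a * (a / q) * b * (b / q) * c * (c / q)))

theorem coeffDefect_eq (h0 : q ≠ 0) (hq : ∀ n : ℕ, 0 < n → q ^ n ≠ 1) (L i j k : ℤ) :
    coeffDefect q L i j k = q ^ (TInt i + TInt j + TInt k) *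
      (qPochInv q i * qPochInv q j * qPochInv q k *
      (qPochInv q (L - i - j) * qPochInv q (L - j - k) * qPochInv q (L - k - i))) *
      defectCore q (q ^ L) (q ^ i) (q ^ j) (q ^ k)
        (qPochInt q (L - i)) (qPochInt q (L - i - 1)) (qPochInt q (L - i - 1 - 1))
        (qPochInt q (L - j)) (qPochInt q (L - j - 1)) (qPochInt q (L - j - 1 - 1))
        (qPochInt q (L - k)) (qPochInt q (L - k - 1)) (qPochInt q (L - k - 1 - 1)) := by
  -- Cyclic rotation brings each remaining term to the index pattern of a shift lemma.
  have e1 : coeff q (L - 1) i (j - 1) k = coeff q (L - 1) (j - 1) k i := coeff_rotate ..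
  have e2 : coeff q (L - 1) i j (k - 1) = coeff q (L - 1) (k - 1) i j := by
    rw [coeff_rotate q _ (k - 1)]
  have e3 : coeff q (L - 2) (i - 1) j (k - 1) = coeff q (L - 2) (k - 1) (i - 1) j := by
    rw [coeff_rotate q _ (k - 1)]
  have e4 : coeff q (L - 2) i (j - 1) (k - 1) = coeff q (L - 2) (j - 1) (k - 1) i :=
    coeff_rotate ..
  have e5 : coeff q (L - 3) (i - 1) (j - 2) (k - 1) = coeff q (L - 3) (j - 2) (k - 1) (i - 1) :=
    coeff_rotate ..
  have e6 : coeff q (L - 3) (i - 1) (j - 1) (k - 2) = coeff q (L - 3) (k - 2) (i - 1) (j - 1) := by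
    rw [coeff_rotate q _ (k - 2)]
  have z1 : q ^ (L - 1) = q ^ L / q := by rw [zpow_sub₀ h0, zpow_one]
  have z2 : q ^ (3 * L - 3) = (q ^ L) ^ 3 / q ^ 3 := by
    rw [zpow_sub₀ h0, mul_comm, zpow_mul]; norm_cast
  have z3 : q ^ (2 * L - 1) = (q ^ L) ^ 2 / q := by
    rw [zpow_sub₀ h0, mul_comm, zpow_mul, zpow_one]; norm_cast
  have t1 : TInt j + TInt k + TInt i = TInt i + TInt j + TInt k := by ring
  have t2 : TInt k + TInt i + TInt j = TInt i + TInt j + TInt k := by ring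
  unfold coeffDefect defectCore
  rw [e1, e2, e3, e4, e5, e6, coeff_shift0 hq, coeff_shift1 h0 hq, coeff_shift1 h0 hq,
    coeff_shift1 h0 hq, coeff_shift2 h0 hq, coeff_shift2 h0 hq, coeff_shift2 h0 hq,
    coeff_shift3 h0 hq, coeff_shift4 h0 hq, coeff_shift4 h0 hq, coeff_shift4 h0 hq,
    coeff_shift5 h0 hq, z1, z2, z3, t1, t2, coeff]
  have w1 : q ^ (L - i - j) = q ^ L / q ^ i / q ^ j := by rw [zpow_sub₀ h0, zpow_sub₀ h0]
  have w2 : q ^ (L - j - k) = q ^ L / q ^ j / q ^ k := by rw [zpow_sub₀ h0, zpow_sub₀ h0]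
  have w3 : q ^ (L - k - i) = q ^ L / q ^ k / q ^ i := by rw [zpow_sub₀ h0, zpow_sub₀ h0]
  rw [w1, w2, w3]
  generalize q ^ (TInt i + TInt j + TInt k) = Q
  generalize (qPochInv q (L - i - j)) = R1
  generalize (qPochInv q (L - j - k)) = R2
  generalize (qPochInv q (L - k - i)) = R3
  generalize qPochInv q i = R4
  generalize qPochInv q j = R5
  generalize qPochInv q k = R6
  generalize q ^ L = x
  generalize q ^ i = a
  generalize q ^ j = b
  generalize q ^ k = c
  ring

/-- Away from the edge each numerator can be stepped down twice, so `p * r * s` factors out and a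
rational identity remains. -/
theorem defectCore_generic {x a b c : K} (h0 : q ≠ 0) (ha : a ≠ 0) (hb : b ≠ 0) (hc : c ≠ 0)
    (p r s : K) :
    defectCore q x a b c ((1 - x / a) * ((1 - x / a / q) * p)) ((1 - x / a / q) * p) p
      ((1 - x / b) * ((1 - x / b / q) * r)) ((1 - x / b / q) * r) r
      ((1 - x / c) * ((1 - x / c / q) * s)) ((1 - x / c / q) * s) s = 0 := by
  unfold defectCore
  field_simp
  ring

theorem qPochInt_eq_one {n : ℤ} (hn : n ≤ 0) : qPochInt q n = 1 := by
  have : n.toNat = 0 := by omega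
  simp [qPochInt, qPoch, this]

theorem qPochInt_two_steps (h0 : q ≠ 0) {L i : ℤ} (h : i ≤ L - 2) :
    qPochInt q (L - i - 1) = (1 - q ^ L / q ^ i / q) * qPochInt q (L - i - 1 - 1) ∧
    qPochInt q (L - i) =
      (1 - q ^ L / q ^ i) * ((1 - q ^ L / q ^ i / q) * qPochInt q (L - i - 1 - 1)) := by
  have h1 := qPochInt_step q (n := L - i - 1) (by omega)
  have h2 := qPochInt_step q (n := L - i) (by omega)
  rw [zpow_sub₀ h0, zpow_sub₀ h0, zpow_one] at h1
  rw [zpow_sub₀ h0, h1] at h2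
  exact ⟨h1, h2⟩

/-- The support conditions leave only i = L with j = k = 0, or i = L - 1 with j, k ≤ 1. The
i-numerators are then explicit, and L ≥ 3 keeps j and k at most L - 2, so their numerators still
step down twice. -/
theorem coeffDefect_edge (h0 : q ≠ 0) (hq : ∀ n : ℕ, 0 < n → q ^ n ≠ 1) {L i j k : ℤ}
    (hL : 3 ≤ L) (hi : L - 1 ≤ i) (hj : 0 ≤ j) (hk : 0 ≤ k) (hij : i + j ≤ L)
    (hik : i + k ≤ L) : coeffDefect q L i j k = 0 := by
  rw [coeffDefect_eq h0 hq]
  apply mul_eq_zero_of_right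
  obtain ⟨r1, r2⟩ := qPochInt_two_steps h0 (show j ≤ L - 2 by omega)
  obtain ⟨s1, s2⟩ := qPochInt_two_steps h0 (show k ≤ L - 2 by omega)
  rw [r2, r1, s2, s1, qPochInt_eq_one (show L - i - 1 ≤ 0 by omega),
    qPochInt_eq_one (show L - i - 1 - 1 ≤ 0 by omega)]
  generalize qPochInt q (L - j - 1 - 1) = r
  generalize qPochInt q (L - k - 1 - 1) = s
  have hx : q ^ i ≠ 0 := zpow_ne_zero _ h0
  obtain rfl | rfl : L = i ∨ L = i + 1 := by omega
  · obtain rfl : j = 0 := by omega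
    obtain rfl : k = 0 := by omega
    rw [qPochInt_eq_one (by omega)]
    generalize q ^ L = x at *
    simp only [zpow_zero]
    unfold defectCore
    field_simp
    ring
  · have h1 := qPochInt_step q (n := i + 1 - i) (by omega)
    rw [qPochInt_eq_one (show i + 1 - i - 1 ≤ 0 by omega), show i + 1 - i = 1 by ring,
      zpow_one] at h1
    rw [show i + 1 - i = 1 by ring, h1, zpow_add₀ h0, zpow_one]
    generalize q ^ i = x at *
    obtain rfl | rfl : j = 0 ∨ j = 1 := by omega
    all_goals
      obtain rfl | rfl : k = 0 ∨ k = 1 := by omega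
      all_goals
        simp only [zpow_zero, zpow_one]
        unfold defectCore
        field_simp
        ring

theorem coeffDefect_eq_zero (h0 : q ≠ 0) (hq : ∀ n : ℕ, 0 < n → q ^ n ≠ 1) {L : ℤ}
    (hL : 3 ≤ L) (i j k : ℤ) : coeffDefect q L i j k = 0 := by
  by_cases h : 0 ≤ i ∧ 0 ≤ j ∧ 0 ≤ k ∧ 0 ≤ L - i - j ∧ 0 ≤ L - j - k ∧ 0 ≤ L - k - i
  · obtain ⟨hi, hj, hk, hij, hjk, hki⟩ := h
    by_cases hi' : L - 1 ≤ i
    · exact coeffDefect_edge h0 hq hL hi' hj hk (by omega) (by omega)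
    by_cases hj' : L - 1 ≤ j
    · rw [coeffDefect_rotate]
      exact coeffDefect_edge h0 hq hL hj' hk hi (by omega) (by omega)
    by_cases hk' : L - 1 ≤ k
    · rw [coeffDefect_rotate, coeffDefect_rotate]
      exact coeffDefect_edge h0 hq hL hk' hi hj (by omega) (by omega)
    rw [coeffDefect_eq h0 hq]
    obtain ⟨p1, p2⟩ := qPochInt_two_steps h0 (show i ≤ L - 2 by omega)
    obtain ⟨r1, r2⟩ := qPochInt_two_steps h0 (show j ≤ L - 2 by omega)
    obtain ⟨s1, s2⟩ := qPochInt_two_steps h0 (show k ≤ L - 2 by omega)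
    rw [p2, p1, r2, r1, s2, s1, defectCore_generic h0 (zpow_ne_zero _ h0) (zpow_ne_zero _ h0)
      (zpow_ne_zero _ h0), mul_zero]
  -- Off the support of the unshifted coefficient the common factor vanishes, and with it all
  -- shifted terms.
  · rw [coeffDefect_eq h0 hq]
    apply mul_eq_zero_of_left
    apply mul_eq_zero_of_right
    have : i < 0 ∨ j < 0 ∨ k < 0 ∨ L - i - j < 0 ∨ L - j - k < 0 ∨ L - k - i < 0 := by omega
    rcases this with h | h | h | h | h | h <;> simp [qPochInv_of_neg q h]

theorem coeff_eq_zero {L i j k : ℤ}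
    (h : i < 0 ∨ j < 0 ∨ k < 0 ∨ L < i + j ∨ L < j + k ∨ L < k + i) : coeff q L i j k = 0 := by
  have : i < 0 ∨ j < 0 ∨ k < 0 ∨ L - i - j < 0 ∨ L - j - k < 0 ∨ L - k - i < 0 := by omega
  unfold coeff
  rcases this with h | h | h | h | h | h <;> simp [qPochInv_of_neg q h]

theorem qBinom_eq (q : K) {N n : ℤ} :
    qBinom q N n = qPochInt q N * (qPochInv q n * qPochInv q (N - n)) := by
  unfold qBinom qPochInt qPochInv
  by_cases h1 : 0 ≤ n <;> by_cases h2 : 0 ≤ N - n <;> simp [h1, div_eq_mul_inv, mul_comm]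

theorem rhsTerm_eq_coeff (q A B C : K) (L i j k : ℕ) :
    rhsTerm q A B C L i j k = coeff q L i j k * (A ^ i * B ^ j * C ^ k) := by
  unfold rhsTerm coeff
  rw [qBinom_eq, qBinom_eq, qBinom_eq, TInt_natCast, TInt_natCast, TInt_natCast]
  have : q ^ ((T i : ℤ) + T j + T k) = q ^ (T i + T j + T k) := by
    exact_mod_cast zpow_natCast q (T i + T j + T k)
  rw [this]
  ring

/-! ### From coefficients to the polynomial recurrence -/

/-- The sum of `h i j k * A^i B^j C^k` over `0 ≤ i, j, k < M`. -/
def boxSum (A B C : K) (M : ℕ) (h : ℤ → ℤ → ℤ → K) : K :=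
  ∑ i ∈ range M, ∑ j ∈ range M, ∑ k ∈ range M, h i j k * (A ^ i * B ^ j * C ^ k)

/-- Multiplying by `A` shifts the index; the two hypotheses kill the terms that enter and leave the
finite range. -/
theorem mul_sum_pow_range {A : K} {M : ℕ} {f : ℤ → K} (h1 : f (-1) = 0) (h2 : f (M - 1) = 0) :
    A * ∑ i ∈ range M, f i * A ^ i = ∑ i ∈ range M, f (i - 1) * A ^ i := by
  cases M with
  | zero => simp
  | succ M =>
    rw [sum_range_succ, sum_range_succ']
    push_cast at h2 ⊢
    rw [show (M : ℤ) + 1 - 1 = M by ring] at h2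
    simp only [h1, h2, zero_mul, add_zero, mul_sum, add_sub_cancel_right]
    exact sum_congr rfl fun i _ => by ring

theorem mul_boxSum_fst {A B C : K} {M : ℕ} {h : ℤ → ℤ → ℤ → K} (h1 : ∀ j k, h (-1) j k = 0)
    (h2 : ∀ j k : ℕ, h (M - 1) j k = 0) :
    A * boxSum A B C M h = boxSum A B C M fun i j k => h (i - 1) j k := by
  have e : ∀ g : ℤ → ℤ → ℤ → K, boxSum A B C M g =
      ∑ i ∈ range M, (∑ j ∈ range M, ∑ k ∈ range M, g i j k * (B ^ j * C ^ k)) * A ^ i := by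
    intro g
    simp only [boxSum, sum_mul]
    exact sum_congr rfl fun i _ => sum_congr rfl fun j _ => sum_congr rfl fun k _ => by ring
  rw [e, e]
  exact mul_sum_pow_range
    (f := fun i => ∑ j ∈ range M, ∑ k ∈ range M, h i j k * (B ^ j * C ^ k))
    (by simp [h1]) (by simp [h2])

theorem boxSum_rotate (A B C : K) (M : ℕ) (h : ℤ → ℤ → ℤ → K) :
    boxSum A B C M h = boxSum B C A M fun j k i => h i j k := by
  unfold boxSum
  rw [sum_comm]
  refine sum_congr rfl fun j _ => ?_
  rw [sum_comm]
  exact sum_congr rfl fun k _ => sum_congr rfl fun i _ => by ring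

theorem mul_boxSum_snd {A B C : K} {M : ℕ} {h : ℤ → ℤ → ℤ → K} (h1 : ∀ i k, h i (-1) k = 0)
    (h2 : ∀ i k : ℕ, h i (M - 1) k = 0) :
    B * boxSum A B C M h = boxSum A B C M fun i j k => h i (j - 1) k := by
  rw [boxSum_rotate A, boxSum_rotate A, mul_boxSum_fst]
  · exact fun j k => h1 k j
  · exact fun j k => h2 k j

theorem mul_boxSum_trd {A B C : K} {M : ℕ} {h : ℤ → ℤ → ℤ → K} (h1 : ∀ i j, h i j (-1) = 0)
    (h2 : ∀ i j : ℕ, h i j (M - 1) = 0) :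
    C * boxSum A B C M h = boxSum A B C M fun i j k => h i j (k - 1) := by
  rw [boxSum_rotate A, boxSum_rotate A, mul_boxSum_snd]
  · exact fun j k => h1 k j
  · exact fun j k => h2 k j

/-- The `q`-binomial side, for an integer bound `L`. -/
def rhsSum (q A B C : K) (L : ℤ) : K := boxSum A B C (L + 1).toNat (coeff q L)

theorem rhsSum_natCast (q A B C : K) (L : ℕ) :
    rhsSum q A B C L = ∑ i ∈ range (L + 1), ∑ j ∈ range (L + 1), ∑ k ∈ range (L + 1),
      rhsTerm q A B C L i j k := by
  rw [rhsSum, show ((L : ℤ) + 1).toNat = L + 1 by omega]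
  simp only [boxSum, rhsTerm_eq_coeff]

theorem boxSum_eq_rhsSum (A B C : K) {M : ℕ} {L : ℤ} (h : L + 1 ≤ M) :
    boxSum A B C M (coeff q L) = rhsSum q A B C L := by
  have hs : range (L + 1).toNat ⊆ range M := by
    intro x; simp only [mem_range]; omega
  unfold rhsSum boxSum
  symm
  refine (sum_congr rfl fun i _ => ?_).trans (sum_subset hs fun i _ hi => ?_)
  · refine (sum_congr rfl fun j _ => ?_).trans (sum_subset hs fun j _ hj => ?_)
    · refine sum_subset hs fun k _ hk => ?_
      rw [mem_range] at hk
      rw [coeff_eq_zero (by omega), zero_mul]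
    · rw [mem_range] at hj
      exact sum_eq_zero fun k _ => by rw [coeff_eq_zero (by omega), zero_mul]
  · rw [mem_range] at hi
    exact sum_eq_zero fun j _ => sum_eq_zero fun k _ => by
      rw [coeff_eq_zero (by omega), zero_mul]

theorem rhsSum_recurrence (h0 : q ≠ 0) (hq : ∀ n : ℕ, 0 < n → q ^ n ≠ 1) (A B C : K) {L : ℤ}
    (hL : 3 ≤ L) :
    rhsSum q A B C L = rhsSum q A B C (L - 1)
      + q ^ L * (A + B + C) * rhsSum q A B C (L - 1)
      + q ^ L * (1 - q ^ (L - 1)) * (A * B + A * C + B * C) * rhsSum q A B C (L - 2)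
      + q ^ (3 * L - 3) * (A * B * C) * rhsSum q A B C (L - 3)
      + q ^ (2 * L - 1) * (A * B * C) * (A + B + C) * rhsSum q A B C (L - 3)
      + q ^ (3 * L - 3) * (A * B * C) ^ 2 * rhsSum q A B C (L - 4) := by
  obtain ⟨M, hM⟩ : ∃ M : ℕ, (M : ℤ) = L + 1 := ⟨(L + 1).toNat, by omega⟩
  -- All sums are put into the one box of side L + 1, so that the recurrence can be compared
  -- termwise. The conditions such as `L' + a < L` below ensure that nothing is lost at the top face
  -- when an index is shifted.
  set S : ℤ → ℤ → ℤ → ℤ → K := fun L' a b c =>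
    boxSum A B C M fun i j k => coeff q L' (i - a) (j - b) (k - c) with hS
  have hA : ∀ L' a b c : ℤ, L' + a < L → 0 ≤ a → A * S L' a b c = S L' (a + 1) b c := by
    intro L' a b c h ha
    have := mul_boxSum_fst (A := A) (B := B) (C := C) (M := M)
      (h := fun i j k => coeff q L' (i - a) (j - b) (k - c))
      (fun j k => coeff_eq_zero (by omega)) (fun j k => coeff_eq_zero (by omega))
    simp only [hS, this, sub_sub, add_comm 1 a]
  have hB : ∀ L' a b c : ℤ, L' + b < L → 0 ≤ b → B * S L' a b c = S L' a (b + 1) c := by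
    intro L' a b c h hb
    have := mul_boxSum_snd (A := A) (B := B) (C := C) (M := M)
      (h := fun i j k => coeff q L' (i - a) (j - b) (k - c))
      (fun j k => coeff_eq_zero (by omega)) (fun j k => coeff_eq_zero (by omega))
    simp only [hS, this, sub_sub, add_comm 1 b]
  have hC : ∀ L' a b c : ℤ, L' + c < L → 0 ≤ c → C * S L' a b c = S L' a b (c + 1) := by
    intro L' a b c h hc
    have := mul_boxSum_trd (A := A) (B := B) (C := C) (M := M)
      (h := fun i j k => coeff q L' (i - a) (j - b) (k - c))
      (fun j k => coeff_eq_zero (by omega)) (fun j k => coeff_eq_zero (by omega))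
    simp only [hS, this, sub_sub, add_comm 1 c]
  have hr : ∀ L' : ℤ, L' ≤ L → rhsSum q A B C L' = S L' 0 0 0 := by
    intro L' h
    rw [← boxSum_eq_rhsSum A B C (M := M) (by omega)]
    simp only [hS, sub_zero]
  have key : S L 0 0 0 = S (L - 1) 0 0 0
      + q ^ L * (S (L - 1) 1 0 0 + S (L - 1) 0 1 0 + S (L - 1) 0 0 1)
      + q ^ L * (1 - q ^ (L - 1)) * (S (L - 2) 1 1 0 + S (L - 2) 1 0 1 + S (L - 2) 0 1 1)
      + q ^ (3 * L - 3) * S (L - 3) 1 1 1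
      + q ^ (2 * L - 1) * (S (L - 3) 2 1 1 + S (L - 3) 1 2 1 + S (L - 3) 1 1 2)
      + q ^ (3 * L - 3) * S (L - 4) 2 2 2 := by
    simp only [hS, boxSum, mul_sum, ← sum_add_distrib]
    refine sum_congr rfl fun i _ => sum_congr rfl fun j _ => sum_congr rfl fun k _ => ?_
    have := coeffDefect_eq_zero h0 hq hL i j k
    unfold coeffDefect at this
    simp only [sub_zero]
    linear_combination this * (A ^ i * B ^ j * C ^ k)
  have a1 := hA (L - 1) 0 0 0 (by omega) le_rfl
  have a2 := hB (L - 1) 0 0 0 (by omega) le_rfl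
  have a3 := hC (L - 1) 0 0 0 (by omega) le_rfl
  have b1 := hA (L - 2) 0 0 0 (by omega) le_rfl
  have b2 := hB (L - 2) 1 0 0 (by omega) le_rfl
  have b3 := hC (L - 2) 1 0 0 (by omega) le_rfl
  have b4 := hB (L - 2) 0 0 0 (by omega) le_rfl
  have b5 := hC (L - 2) 0 1 0 (by omega) le_rfl
  have c1 := hA (L - 3) 0 0 0 (by omega) le_rfl
  have c2 := hB (L - 3) 1 0 0 (by omega) le_rfl
  have c3 := hC (L - 3) 1 1 0 (by omega) le_rfl
  have c4 := hA (L - 3) 1 1 1 (by omega) (by omega)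
  have c5 := hB (L - 3) 1 1 1 (by omega) (by omega)
  have c6 := hC (L - 3) 1 1 1 (by omega) (by omega)
  have d1 := hA (L - 4) 0 0 0 (by omega) le_rfl
  have d2 := hB (L - 4) 1 0 0 (by omega) le_rfl
  have d3 := hC (L - 4) 1 1 0 (by omega) le_rfl
  have d4 := hA (L - 4) 1 1 1 (by omega) (by omega)
  have d5 := hB (L - 4) 2 1 1 (by omega) (by omega)
  have d6 := hC (L - 4) 2 2 1 (by omega) (by omega)
  simp only [zero_add, one_add_one_eq_two] at a1 a2 a3 b1 b2 b3 b4 b5 c1 c2 c3 c4 c5 c6 d1 d2 d3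
  simp only [one_add_one_eq_two] at d4 d5 d6
  rw [hr L le_rfl, hr (L - 1) (by omega), hr (L - 2) (by omega), hr (L - 3) (by omega),
    hr (L - 4) (by omega), key, ← a1, ← a2, ← a3, ← b2, ← b3, ← b5, ← b1, ← b4, ← c4, ← c5,
    ← c6, ← c3, ← c2, ← c1, ← d6, ← d5, ← d4, ← d3, ← d2, ← d1]
  ring

theorem rhsSum_of_neg (q A B C : K) {L : ℤ} (h : L < 0) : rhsSum q A B C L = 0 := by
  rw [rhsSum, show (L + 1).toNat = 0 by omega]
  simp [boxSum]

theorem rhsSum_zero (q A B C : K) : rhsSum q A B C 0 = 1 := by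
  have := rhsSum_natCast q A B C 0
  rw [Nat.cast_zero] at this
  rw [this]
  simp [rhsTerm, qBinom, qPoch, T]

theorem rhsSum_one (hq : ∀ n : ℕ, 0 < n → q ^ n ≠ 1) (A B C : K) :
    rhsSum q A B C 1 = 1 + (A + B + C) * q := by
  have := rhsSum_natCast q A B C 1
  rw [Nat.cast_one] at this
  have h1 : 1 - q ≠ 0 := sub_ne_zero.2 (by simpa using (hq 1 one_pos).symm)
  rw [this]
  simp [rhsTerm, qBinom, qPoch, T, sum_range_succ, h1]
  ring

theorem rhsSum_two (hq : ∀ n : ℕ, 0 < n → q ^ n ≠ 1) (A B C : K) :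
    rhsSum q A B C 2 = 1 + (A + B + C) * q + (A + B + C) * (1 + (A + B + C) * q) * q ^ 2
      + (A * B + A * C + B * C) * (q ^ 2 - q ^ 3) + A * B * C * q ^ 3 := by
  have := rhsSum_natCast q A B C 2
  rw [Nat.cast_two] at this
  have h1 : 1 - q ≠ 0 := sub_ne_zero.2 (by simpa using (hq 1 one_pos).symm)
  have h2 : 1 - q ^ 2 ≠ 0 := sub_ne_zero.2 (hq 2 two_pos).symm
  rw [this]
  simp [rhsTerm, qBinom, qPoch, T, sum_range_succ, prod_range_succ, h1]
  field_simp
  ring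

end Coefficients

/-! ### Type-1 colourings, built up by adding a new largest part -/

section Colourings

variable {R : Type*} [CommRing R]

/-- `Y` may stand directly below `X`: the colour of a part `n` may be `Y` if that of `n + 1`
is `X`. -/
def Colour.Below (Y X : Colour) : Prop := (Y = X ∧ Y.IsPrimary) ∨ Y.rank < X.rank

open Classical in
/-- The sum over the Type-1 colourings of `π` in which the colour of `n`, if `n` is a part,
satisfies `p`. -/
def topSum (A B C : R) (n : ℕ) (π : Finset ℕ) (p : Colour → Prop) : R :=
  ∑ c : π → Colour with IsType1 π c ∧ ∀ x : π, (x : ℕ) = n → p (c x), ∏ x : π, (c x).wt A B C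

theorem topSum_of_notMem (A B C : R) {n : ℕ} {π : Finset ℕ} (h : n ∉ π) (p : Colour → Prop) :
    topSum A B C n π p = colourSum A B C π := by
  unfold topSum colourSum
  congr 1
  ext c
  simp only [mem_filter, mem_univ, true_and, and_iff_left_iff_imp]
  rintro - ⟨x, hx⟩ rfl
  exact absurd hx h

theorem topSum_true (A B C : R) (n : ℕ) (π : Finset ℕ) :
    topSum A B C n π (fun _ => True) = colourSum A B C π := by
  unfold topSum colourSum
  congr 1
  ext c
  simp

theorem colourSum_empty (A B C : R) : colourSum A B C ∅ = 1 := by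
  classical
  unfold colourSum
  rw [sum_filter, Fintype.sum_unique, if_pos]
  · simp
  · exact ⟨fun x => absurd x.2 (notMem_empty _), fun x => absurd x.2 (notMem_empty _)⟩

/-- The colourings of `insert a s` correspond to a colour of `a` and a colouring of `s`. -/
def insertColouring {a : ℕ} {s : Finset ℕ} (h : a ∉ s) :
    (↥(insert a s) → Colour) ≃ Colour × (s → Colour) :=
  ((subtypeInsertEquivOption h).arrowCongr (Equiv.refl Colour)).trans
    (Equiv.piOptionEquivProd (β := fun _ => Colour))

theorem insertColouring_symm_self {a : ℕ} {s : Finset ℕ} (h : a ∉ s) (X : Colour)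
    (c : s → Colour) : (insertColouring h).symm (X, c) ⟨a, mem_insert_self a s⟩ = X := by
  simp [insertColouring, subtypeInsertEquivOption, Equiv.piOptionEquivProd, Equiv.arrowCongr]

theorem insertColouring_symm_of_mem {a : ℕ} {s : Finset ℕ} (h : a ∉ s) (X : Colour)
    (c : s → Colour) (x : s) :
    (insertColouring h).symm (X, c) ⟨x, mem_insert_of_mem x.2⟩ = c x := by
  have : (x : ℕ) ≠ a := fun e => h (e ▸ x.2)
  simp [insertColouring, subtypeInsertEquivOption, Equiv.piOptionEquivProd, Equiv.arrowCongr, this]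

theorem isType1_insertColouring {n : ℕ} {π : Finset ℕ} (hπ : ∀ x ∈ π, x ≤ n) (hn : n + 1 ∉ π)
    (p : Colour → Prop) (X : Colour) (c : π → Colour) :
    (IsType1 (insert (n + 1) π) ((insertColouring hn).symm (X, c)) ∧
      ∀ x : ↥(insert (n + 1) π), (x : ℕ) = n + 1 → p ((insertColouring hn).symm (X, c) x)) ↔
    (p X ∧ (n = 0 → X.IsPrimary)) ∧ (IsType1 π c ∧ ∀ x : π, (x : ℕ) = n → (c x).Below X) := by
  have e1 := insertColouring_symm_self hn X c
  have e2 := insertColouring_symm_of_mem hn X c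
  constructor
  · rintro ⟨⟨h1, h2⟩, h3⟩
    refine ⟨⟨?_, ?_⟩, ⟨?_, ?_⟩, ?_⟩
    · simpa only [e1] using h3 ⟨n + 1, mem_insert_self _ _⟩ rfl
    · rintro rfl
      simpa only [e1] using h1 ⟨0 + 1, mem_insert_self _ _⟩ rfl
    · intro x hx
      simpa only [e2] using h1 ⟨x, mem_insert_of_mem x.2⟩ hx
    · intro x y hxy
      simpa only [e2] using h2 ⟨x, mem_insert_of_mem x.2⟩ ⟨y, mem_insert_of_mem y.2⟩ hxy
    · intro x hx
      simpa only [Colour.Below, e1, e2] using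
        h2 ⟨x, mem_insert_of_mem x.2⟩ ⟨n + 1, mem_insert_self _ _⟩ (by simp [hx])
  · rintro ⟨⟨h1, h2⟩, ⟨h3, h4⟩, h5⟩
    refine ⟨⟨?_, ?_⟩, ?_⟩
    · rintro ⟨x, hx⟩ h
      obtain rfl | hx' := mem_insert.1 hx
      · rw [e1]; exact h2 (by simpa using h)
      · rw [e2 ⟨x, hx'⟩]; exact h3 ⟨x, hx'⟩ h
    · rintro ⟨x, hx⟩ ⟨y, hy⟩ h
      simp only at h
      obtain rfl | hx' := mem_insert.1 hx
      · obtain rfl | hy' := mem_insert.1 hy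
        · omega
        · have := hπ y hy'; omega
      · rw [e2 ⟨x, hx'⟩]
        obtain rfl | hy' := mem_insert.1 hy
        · rw [e1]; exact h5 ⟨x, hx'⟩ (by simpa using h.symm)
        · rw [e2 ⟨y, hy'⟩]; exact h4 ⟨x, hx'⟩ ⟨y, hy'⟩ h
    · rintro ⟨x, hx⟩ h
      simp only at h
      subst h
      rw [e1]; exact h1

open Classical in
/-- Splitting off the colour of the largest part. -/
theorem topSum_insert (A B C : R) {n : ℕ} {π : Finset ℕ} (hπ : ∀ x ∈ π, x ≤ n)
    (p : Colour → Prop) :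
    topSum A B C (n + 1) (insert (n + 1) π) p =
      ∑ X : Colour, if p X ∧ (n = 0 → X.IsPrimary) then
        X.wt A B C * topSum A B C n π (fun Y => Y.Below X) else 0 := by
  have hn : n + 1 ∉ π := fun h => by have := hπ _ h; omega
  unfold topSum
  rw [sum_filter, ← (insertColouring hn).symm.sum_comp, Fintype.sum_prod_type]
  refine sum_congr rfl fun X _ => ?_
  simp only [isType1_insertColouring hπ hn p]
  have hprod : ∀ c : π → Colour,
      ∏ x, ((insertColouring hn).symm (X, c) x).wt A B C = X.wt A B C * ∏ x, (c x).wt A B C := by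
    intro c
    rw [← (subtypeInsertEquivOption hn).symm.prod_comp, Fintype.prod_option]
    congr 1
    · exact congrArg _ (insertColouring_symm_self hn X c)
    · exact prod_congr rfl fun x _ => congrArg _ (insertColouring_symm_of_mem hn X c x)
  simp only [hprod]
  by_cases h : p X ∧ (n = 0 → X.IsPrimary)
  · rw [if_pos h, sum_filter, mul_sum]
    refine sum_congr rfl fun c _ => ?_
    rw [mul_ite, mul_zero]
    exact if_congr (and_iff_right h) rfl rfl
  · rw [if_neg h]
    exact sum_eq_zero fun c _ => if_neg fun hc => h hc.1

theorem sum_colour (f : Colour → R) :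
    ∑ X, f X = f .AB + f .AC + f .A + f .BC + f .B + f .C := by
  change ∑ X ∈ ({.AB, .AC, .A, .BC, .B, .C} : Finset Colour), f X = _
  simp [add_assoc]

/-- The colours that may stand directly below `X` are those of rank less than `X.cut`. -/
def Colour.cut : Colour → ℕ
  | .AB => 0 | .AC => 1 | .A => 3 | .BC => 3 | .B => 5 | .C => 6

/-- The admissible colours form an initial segment, ending with `X` itself if `X` is primary and
just before it otherwise. Hence sums with a bound on the top rank are closed under adding a part. -/
theorem Colour.below_iff (Y X : Colour) : Y.Below X ↔ Y.rank < X.cut := by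
  cases X <;> cases Y <;> simp [Below, IsPrimary, rank, cut]

/-- The sum over the Type-1 colourings of `π` in which the colour of `n`, if `n` is a part, has
rank less than `r`. -/
def rankSum (A B C : R) (n : ℕ) (π : Finset ℕ) (r : ℕ) : R :=
  topSum A B C n π fun X => X.rank < r

theorem rankSum_six (A B C : R) (n : ℕ) (π : Finset ℕ) :
    rankSum A B C n π 6 = colourSum A B C π := by
  rw [← topSum_true A B C n, rankSum]
  congr 1
  ext X
  cases X <;> simp [Colour.rank]

theorem rankSum_of_notMem (A B C : R) {n : ℕ} {π : Finset ℕ} (h : n ∉ π) (r : ℕ) :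
    rankSum A B C n π r = colourSum A B C π := topSum_of_notMem A B C h _

open Classical in
theorem rankSum_insert (A B C : R) {n : ℕ} {π : Finset ℕ} (hπ : ∀ x ∈ π, x ≤ n) (r : ℕ) :
    rankSum A B C (n + 1) (insert (n + 1) π) r =
      ∑ X : Colour, if X.rank < r ∧ (n = 0 → X.IsPrimary) then
        X.wt A B C * rankSum A B C n π X.cut else 0 := by
  simp only [rankSum, topSum_insert A B C hπ, Colour.below_iff]

open Classical in
/-- One step of the transfer from largest part at most `n` to largest part `n + 1`. -/
def transfer (A B C : R) (n : ℕ) (v : ℕ → R) (r : ℕ) : R :=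
  ∑ X : Colour, if X.rank < r ∧ (n = 0 → X.IsPrimary) then X.wt A B C * v X.cut else 0

theorem transfer_of_pos (A B C : R) {n : ℕ} (hn : n ≠ 0) (v : ℕ → R) :
    transfer A B C n v 0 = 0 ∧
    transfer A B C n v 1 = A * B * v 0 ∧
    transfer A B C n v 2 = transfer A B C n v 1 + A * C * v 1 ∧
    transfer A B C n v 3 = transfer A B C n v 2 + A * v 3 ∧
    transfer A B C n v 4 = transfer A B C n v 3 + B * C * v 3 ∧
    transfer A B C n v 5 = transfer A B C n v 4 + B * v 5 ∧
    transfer A B C n v 6 = transfer A B C n v 5 + C * v 6 := by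
  simp [transfer, sum_colour, hn, Colour.rank, Colour.wt, Colour.cut]

theorem transfer_zero (A B C : R) (v : ℕ → R) :
    transfer A B C 0 v 0 = 0 ∧
    transfer A B C 0 v 1 = 0 ∧
    transfer A B C 0 v 2 = 0 ∧
    transfer A B C 0 v 3 = A * v 3 ∧
    transfer A B C 0 v 4 = A * v 3 ∧
    transfer A B C 0 v 5 = A * v 3 + B * v 5 ∧
    transfer A B C 0 v 6 = A * v 3 + B * v 5 + C * v 6 := by
  simp [transfer, sum_colour, Colour.rank, Colour.wt, Colour.cut, Colour.IsPrimary]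

end Colourings

/-! ### Complete homogeneous sums -/

section CompleteSums

variable {R : Type*} [CommRing R]

theorem h3_eq_box (A B C : R) {n : ℤ} {N₁ N₂ N₃ : ℕ} (h₁ : n < N₁) (h₂ : n < N₂) (h₃ : n < N₃) :
    h3 A B C n = ∑ i ∈ range N₁, ∑ j ∈ range N₂, ∑ k ∈ range N₃,
      if (i : ℤ) + j + k = n then A ^ i * B ^ j * C ^ k else 0 := by
  rcases lt_or_ge n 0 with hn | hn
  · unfold h3
    rw [sum_eq_zero, sum_eq_zero]
    all_goals
      exact fun i _ => sum_eq_zero fun j _ => sum_eq_zero fun k _ => if_neg (by omega)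
  have hs : ∀ N : ℕ, n < N → range (n.toNat + 1) ⊆ range N := by
    intro N hN x; simp only [mem_range]; omega
  unfold h3
  refine (sum_congr rfl fun i _ => ?_).trans (sum_subset (hs _ h₁) fun i _ hi => ?_)
  · refine (sum_congr rfl fun j _ => ?_).trans (sum_subset (hs _ h₂) fun j _ hj => ?_)
    · refine sum_subset (hs _ h₃) fun k _ hk => ?_
      rw [mem_range] at hk
      exact if_neg (by omega)
    · rw [mem_range] at hj
      exact sum_eq_zero fun k _ => if_neg (by omega)
  · rw [mem_range] at hi
    exact sum_eq_zero fun j _ => sum_eq_zero fun k _ => if_neg (by omega)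

theorem h2_eq_box (B C : R) {n : ℤ} {N₂ N₃ : ℕ} (h₂ : n < N₂) (h₃ : n < N₃) :
    h2 B C n = ∑ j ∈ range N₂, ∑ k ∈ range N₃,
      if (j : ℤ) + k = n then B ^ j * C ^ k else 0 := by
  rcases lt_or_ge n 0 with hn | hn
  · unfold h2
    rw [sum_eq_zero, sum_eq_zero]
    all_goals exact fun j _ => sum_eq_zero fun k _ => if_neg (by omega)
  have hs : ∀ N : ℕ, n < N → range (n.toNat + 1) ⊆ range N := by
    intro N hN x; simp only [mem_range]; omega
  unfold h2
  refine (sum_congr rfl fun j _ => ?_).trans (sum_subset (hs _ h₂) fun j _ hj => ?_)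
  · refine sum_subset (hs _ h₃) fun k _ hk => ?_
    rw [mem_range] at hk
    exact if_neg (by omega)
  · rw [mem_range] at hj
    exact sum_eq_zero fun k _ => if_neg (by omega)

/-- The power `A ^ n`, extended by `0` to negative `n`. -/
def h1 (A : R) (n : ℤ) : R := if 0 ≤ n then A ^ n.toNat else 0

/-- Separate the terms with exponent k = 0 from those divisible by `C`. This mirrors the recursion
in which the topmost part of a run does or does not have colour C. -/
theorem h3_step_last (A B C : R) (n : ℤ) : h3 A B C n = h2 A B n + C * h3 A B C (n - 1) := by
  have hn : n - 1 < n.toNat := by omega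
  rw [h3_eq_box A B C (n := n - 1) (N₁ := n.toNat + 1) (N₂ := n.toNat + 1) (by omega) (by omega) hn,
    h3, h2, mul_sum, ← sum_add_distrib]
  refine sum_congr rfl fun i _ => ?_
  rw [mul_sum, ← sum_add_distrib]
  refine sum_congr rfl fun j _ => ?_
  rw [sum_range_succ', mul_sum, add_comm]
  congr 1
  · simp
  · refine sum_congr rfl fun k _ => ?_
    by_cases h : (i : ℤ) + j + k = n - 1
    · rw [if_pos h, if_pos (by push_cast; omega)]; ring
    · rw [if_neg h, if_neg (by push_cast; omega), mul_zero]

theorem h3_step_first (A B C : R) (n : ℤ) : h3 A B C n = h2 B C n + A * h3 A B C (n - 1) := by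
  have hn : n - 1 < n.toNat := by omega
  rw [h3_eq_box A B C (n := n - 1) (N₂ := n.toNat + 1) (N₃ := n.toNat + 1) hn (by omega) (by omega),
    h3, h2, sum_range_succ', add_comm]
  congr 1
  · simp
  · simp only [mul_sum]
    refine sum_congr rfl fun i _ => sum_congr rfl fun j _ => sum_congr rfl fun k _ => ?_
    by_cases h : (i : ℤ) + j + k = n - 1
    · rw [if_pos h, if_pos (by push_cast; omega)]; ring
    · rw [if_neg h, if_neg (by push_cast; omega), mul_zero]

theorem h2_step (A B : R) (n : ℤ) : h2 A B n = h1 A n + B * h2 A B (n - 1) := by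
  have hn : n - 1 < n.toNat := by omega
  rw [h2_eq_box A B (n := n - 1) (N₂ := n.toNat + 1) (by omega) hn, h2, mul_sum]
  have e : h1 A n = ∑ j ∈ range (n.toNat + 1), if (j : ℤ) = n then A ^ j else 0 := by
    unfold h1
    by_cases h : 0 ≤ n
    · obtain ⟨m, rfl⟩ := Int.eq_ofNat_of_zero_le h
      simp
    · rw [if_neg h, sum_eq_zero fun j _ => if_neg (by omega)]
  rw [e, ← sum_add_distrib]
  refine sum_congr rfl fun j _ => ?_
  rw [sum_range_succ', mul_sum, add_comm]
  congr 1
  · simp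
  · refine sum_congr rfl fun k _ => ?_
    by_cases h : (j : ℤ) + k = n - 1
    · rw [if_pos h, if_pos (by push_cast; omega)]; ring
    · rw [if_neg h, if_neg (by push_cast; omega), mul_zero]

theorem h1_step (A : R) (n : ℤ) : h1 A n = (if n = 0 then 1 else 0) + A * h1 A (n - 1) := by
  unfold h1
  rcases lt_trichotomy n 0 with h | rfl | h
  · simp [show ¬ 0 ≤ n by omega, show ¬ 1 ≤ n by omega, h.ne]
  · simp
  · obtain ⟨m, rfl⟩ : ∃ m : ℕ, n = m + 1 := ⟨(n - 1).toNat, by omega⟩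
    have e1 : ((m : ℤ) + 1).toNat = m + 1 := by omega
    simp [e1, show (0 : ℤ) ≤ m + 1 by omega, show (m : ℤ) + 1 ≠ 0 by omega, pow_succ']

/-- The last two terms of `F` recombine by splitting `h3` at l - 1 according to the power of `A`. In
generating functions, F is (1+BCx) / ((1-Ax)(1-Bx)(1-Cx)). -/
theorem F_eq (A B C : R) (l : ℤ) : F A B C l = h3 A B C l + B * C * h3 A B C (l - 1) := by
  have := h3_step_first A B C (l - 1)
  rw [show l - 1 - 1 = l - 2 by ring] at this
  unfold F
  linear_combination -(B * C) * this

end CompleteSums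

/-! ### Colour sums of a single run -/

section ChainSums

variable {R : Type*} [CommRing R]

/-- The `rankSum`s of a run of `l` parts above `m`. -/
def runSum (A B C : R) (m l r : ℕ) : R := rankSum A B C (m + l) (Icc (m + 1) (m + l)) r

theorem Icc_add_succ (m l : ℕ) :
    Icc (m + 1) (m + (l + 1)) = insert (m + l + 1) (Icc (m + 1) (m + l)) := by
  ext x; simp only [mem_Icc, mem_insert]; omega

theorem runSum_zero (A B C : R) (m r : ℕ) : runSum A B C m 0 r = 1 := by
  rw [runSum, rankSum_of_notMem, Icc_eq_empty (by omega), colourSum_empty]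
  simp

theorem runSum_succ (A B C : R) (m l : ℕ) :
    runSum A B C m (l + 1) = transfer A B C (m + l) (runSum A B C m l) := by
  ext r
  rw [runSum, Icc_add_succ, ← add_assoc, rankSum_insert]
  · rfl
  · intro x; simp only [mem_Icc]; omega

/-- Since m is not a part, no colour condition links `π` to the run above m, and the sum factors. -/
theorem rankSum_union_run (A B C : R) {m : ℕ} {π : Finset ℕ} (hπ : ∀ x ∈ π, x < m) (l r : ℕ) :
    rankSum A B C (m + l) (π ∪ Icc (m + 1) (m + l)) r =
      colourSum A B C π * runSum A B C m l r := by
  classical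
  induction l generalizing r with
  | zero =>
    rw [runSum_zero, mul_one, Icc_eq_empty (by omega), union_empty, rankSum_of_notMem]
    intro h
    exact absurd (hπ _ h) (by omega)
  | succ l ih =>
    rw [Icc_add_succ, union_insert, ← add_assoc, rankSum_insert, runSum_succ, transfer, mul_sum]
    · refine sum_congr rfl fun X _ => ?_
      rw [ih, mul_ite, mul_zero]
      congr 1
      ring
    · intro x hx
      rcases mem_union.1 hx with h | h
      · have := hπ x h; omega
      · rw [mem_Icc] at h; omega

theorem colourSum_union_run (A B C : R) {m : ℕ} {π : Finset ℕ} (hπ : ∀ x ∈ π, x < m) (l : ℕ) :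
    colourSum A B C (π ∪ Icc (m + 1) (m + l)) =
      colourSum A B C π * runSum A B C m l 6 := by
  rw [← rankSum_union_run A B C hπ, rankSum_six]

/-- The sums of a run not starting at `1`. -/
theorem runSum_of_pos (A B C : R) {m : ℕ} (hm : m ≠ 0) (l : ℕ) :
    runSum A B C m l 6 =
      F A B C l + A * (B + C) * F A B C (l - 1) + A ^ 2 * B * C * F A B C (l - 2) := by
  have step := fun l => transfer_of_pos A B C (n := m + l) (by omega) (runSum A B C m l)
  simp only [← runSum_succ] at step
  have z := runSum_zero A B C m
  simp only [F_eq]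
  -- Colours are admitted in increasing order: with only AB and AC, each usable once, the run has at
  -- most two parts. Then A contributes 1/(1-Ax), BC and B contribute (1+BCx)/(1-Bx), and C
  -- contributes 1/(1-Cx).
  have u2 : ∀ l, runSum A B C m (l + 1) 2 =
      if l = 0 then A * B + A * C else if l = 1 then A * B * (A * C) else 0 := by
    rintro (_ | _ | l)
    · obtain ⟨-, h1, h2, -⟩ := step 0
      rw [h2, h1, z, z]; simp
    · obtain ⟨-, h1, h2, -⟩ := step 1
      obtain ⟨h3, h4, -⟩ := step 0
      rw [h2, h1, h3, h4, z]; simp; ring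
    · obtain ⟨-, h1, h2, -⟩ := step (l + 2)
      obtain ⟨h3, h4, -⟩ := step (l + 1)
      obtain ⟨h5, -⟩ := step l
      rw [h2, h1, h3, h4, h5]; simp
  have u3 : ∀ l : ℕ, runSum A B C m l 3 =
      h1 A l + A * (B + C) * h1 A (l - 1) + A ^ 2 * B * C * h1 A (l - 2) := by
    intro l
    induction l with
    | zero => rw [z]; simp [h1]
    | succ l ih =>
      obtain ⟨-, -, -, h, -⟩ := step l
      have e1 := h1_step A ((l : ℤ) + 1)
      have e2 := h1_step A (l : ℤ)
      have e3 := h1_step A ((l : ℤ) - 1)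
      rw [if_neg (by omega), show (l : ℤ) + 1 - 1 = l by ring] at e1
      rw [show (l : ℤ) - 1 - 1 = l - 2 by ring] at e3
      rw [h, ih, u2]
      push_cast
      rw [show (l : ℤ) + 1 - 1 = l by ring, show (l : ℤ) + 1 - 2 = l - 1 by ring, e1]
      -- The inhomogeneous term of `h1_step` is nonzero only at l = 0 (in `e2`) and l = 1 (in `e3`),
      -- exactly where `u2` contributes.
      rcases l with _ | _ | l
      · rw [if_pos rfl]
        rw [if_pos (by simp)] at e2
        rw [if_neg (by simp)] at e3
        linear_combination (-A * (B + C)) * e2 - A ^ 2 * B * C * e3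
      · rw [if_neg (by omega), if_pos rfl]
        rw [if_neg (by simp)] at e2
        rw [if_pos (by simp)] at e3
        linear_combination (-A * (B + C)) * e2 - A ^ 2 * B * C * e3
      · rw [if_neg (by omega), if_neg (by omega)]
        rw [if_neg (by omega)] at e2
        rw [if_neg (by omega)] at e3
        linear_combination (-A * (B + C)) * e2 - A ^ 2 * B * C * e3
  have u5 : ∀ l : ℕ, runSum A B C m l 5 =
      h2 A B l + B * C * h2 A B (l - 1) + A * (B + C) * (h2 A B (l - 1) + B * C * h2 A B (l - 2))
        + A ^ 2 * B * C * (h2 A B (l - 2) + B * C * h2 A B (l - 3)) := by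
    intro l
    induction l with
    | zero => rw [z]; simp [h2]
    | succ l ih =>
      obtain ⟨-, -, -, -, h4, h5, -⟩ := step l
      have e1 := h2_step A B ((l : ℤ) + 1)
      have e2 := h2_step A B (l : ℤ)
      have e3 := h2_step A B ((l : ℤ) - 1)
      have e4 := h2_step A B ((l : ℤ) - 2)
      rw [show (l : ℤ) + 1 - 1 = l by ring] at e1
      rw [show (l : ℤ) - 1 - 1 = l - 2 by ring] at e3
      rw [show (l : ℤ) - 2 - 1 = l - 3 by ring] at e4
      rw [h5, h4, u3, u3, ih]
      push_cast
      rw [show (l : ℤ) + 1 - 1 = l by ring, show (l : ℤ) + 1 - 2 = l - 1 by ring,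
        show (l : ℤ) + 1 - 3 = l - 2 by ring]
      linear_combination -e1 - (B * C + A * (B + C)) * e2
        - (A * (B + C) * (B * C) + A ^ 2 * B * C) * e3 - A ^ 2 * B * C * (B * C) * e4
  induction l with
  | zero => rw [z]; simp [h3]
  | succ l ih =>
    obtain ⟨-, -, -, -, -, -, h6⟩ := step l
    have e1 := h3_step_last A B C ((l : ℤ) + 1)
    have e2 := h3_step_last A B C (l : ℤ)
    have e3 := h3_step_last A B C ((l : ℤ) - 1)
    have e4 := h3_step_last A B C ((l : ℤ) - 2)
    rw [show (l : ℤ) + 1 - 1 = l by ring] at e1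
    rw [show (l : ℤ) - 1 - 1 = l - 2 by ring] at e3
    rw [show (l : ℤ) - 2 - 1 = l - 3 by ring] at e4
    rw [h6, u5, ih]
    push_cast
    rw [show (l : ℤ) + 1 - 1 = l by ring, show (l : ℤ) + 1 - 2 = l - 1 by ring,
      show (l : ℤ) - 1 - 1 = l - 2 by ring, show (l : ℤ) - 2 - 1 = l - 3 by ring,
      show (l : ℤ) + 1 - 3 = l - 2 by ring]
    linear_combination -e1 - (B * C + A * (B + C)) * e2
      - (A * (B + C) * (B * C) + A ^ 2 * B * C) * e3 - A ^ 2 * B * C * (B * C) * e4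

/-- The sums of a run starting at `1`. -/
theorem runSum_zero_left (A B C : R) (l : ℕ) :
    runSum A B C 0 l 6 = h3 A B C l + A * B * C * h3 A B C (l - 2) := by
  have step0 := transfer_zero A B C (runSum A B C 0 0)
  have step := fun l =>
    transfer_of_pos A B C (n := 0 + (l + 1)) (by omega) (runSum A B C 0 (l + 1))
  have e0 : runSum A B C 0 1 = transfer A B C 0 (runSum A B C 0 0) := runSum_succ A B C 0 0
  rw [← e0] at step0
  simp only [← runSum_succ] at step
  have z := runSum_zero A B C 0
  -- The primary colour of part 1 rules out AB and AC throughout the run, so the bound 3 admits only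
  -- the colour A.
  have u0 : ∀ l, runSum A B C 0 (l + 1) 0 = 0 := by
    rintro (_ | l)
    exacts [step0.1, (step l).1]
  have u1 : ∀ l, runSum A B C 0 (l + 1) 1 = 0 := by
    rintro (_ | l)
    · exact step0.2.1
    · rw [(step l).2.1, u0, mul_zero]
  have u3 : ∀ l, runSum A B C 0 l 3 = A ^ l := by
    intro l
    rcases l with _ | l
    · simp [z]
    · induction l with
      | zero => simp [step0.2.2.2.1, z]
      | succ l ih =>
        obtain ⟨-, h1, h2, h3, -⟩ := step l
        rw [h3, h2, h1, u0, u1, ih]; ring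
  have u4 : ∀ l : ℕ, runSum A B C 0 (l + 1) 4 = h1 A (l + 1) + A * B * C * h1 A (l - 1) := by
    rintro (_ | l)
    · simp [step0.2.2.2.2.1, z, h1]
    · rw [(step l).2.2.2.2.1, u3, u3]
      have e1 : ((l : ℤ) + 1 + 1).toNat = l + 2 := by omega
      simp only [h1, Nat.cast_add, Nat.cast_one, e1, add_sub_cancel_right]
      rw [if_pos (by omega), if_pos (by omega)]
      simp only [Int.toNat_natCast]
      ring
  have s5 : ∀ l, runSum A B C 0 (l + 1) 5 = runSum A B C 0 (l + 1) 4 + B * runSum A B C 0 l 5 := by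
    rintro (_ | l)
    · rw [step0.2.2.2.2.2.1, step0.2.2.2.2.1]
    · exact (step l).2.2.2.2.2.1
  have s6 : ∀ l, runSum A B C 0 (l + 1) 6 = runSum A B C 0 (l + 1) 5 + C * runSum A B C 0 l 6 := by
    rintro (_ | l)
    · rw [step0.2.2.2.2.2.2, step0.2.2.2.2.2.1]
    · exact (step l).2.2.2.2.2.2
  have u5 : ∀ l : ℕ, runSum A B C 0 l 5 = h2 A B l + A * B * C * h2 A B (l - 2) := by
    intro l
    induction l with
    | zero => rw [z]; simp [h2]
    | succ l ih =>
      have e1 := h2_step A B ((l + 1 : ℕ) : ℤ)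
      have e2 := h2_step A B (((l + 1 : ℕ) : ℤ) - 2)
      rw [s5, u4, ih, e1, e2]
      push_cast
      rw [show (l : ℤ) + 1 - 1 = l by ring, show (l : ℤ) + 1 - 2 - 1 = l - 2 by ring,
        show (l : ℤ) + 1 - 2 = l - 1 by ring]
      ring
  induction l with
  | zero => rw [z]; simp [h3]
  | succ l ih =>
    have e1 := h3_step_last A B C ((l + 1 : ℕ) : ℤ)
    have e2 := h3_step_last A B C (((l + 1 : ℕ) : ℤ) - 2)
    rw [s6, u5, ih, e1, e2]
    push_cast
    rw [show (l : ℤ) + 1 - 1 = l by ring, show (l : ℤ) + 1 - 2 - 1 = l - 2 by ring,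
      show (l : ℤ) + 1 - 2 = l - 1 by ring]
    ring

theorem chainWeight_run (A B C : R) (m : ℕ) {l : ℕ} (hl : l ≠ 0) :
    chainWeight A B C (Icc (m + 1) (m + l)) = runSum A B C m l 6 := by
  have hmin : (Icc (m + 1) (m + l)).min = ((m + 1 : ℕ) : WithTop ℕ) := by
    refine le_antisymm (Finset.min_le (a := m + 1) (mem_Icc.2 ⟨le_rfl, by omega⟩)) (Finset.le_min fun x hx => ?_)
    exact WithTop.coe_le_coe.2 (mem_Icc.1 hx).1
  have hcard : #(Icc (m + 1) (m + l)) = l := by simp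
  unfold chainWeight
  simp only [hmin, hcard]
  by_cases hm : m = 0
  · subst hm
    rw [if_pos (by norm_num), runSum_zero_left]
  · rw [if_neg, runSum_of_pos A B C hm]
    intro h
    exact hm (by simpa using WithTop.coe_injective h)

end ChainSums

/-! ### Decomposition of a partition into chains -/

section Chains

variable {R : Type*} [CommRing R]

theorem mem_chains {π χ : Finset ℕ} :
    χ ∈ chains π ↔ Maximal (fun ρ => ρ ⊆ π ∧ IsRun ρ) χ := by
  classical
  unfold chains
  rw [mem_filter, mem_powerset, and_iff_right_iff_imp]
  exact fun h => h.prop.1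

theorem IsRun.nonempty {χ : Finset ℕ} (h : IsRun χ) : χ.Nonempty := by
  obtain ⟨s, t, hst, rfl⟩ := h
  exact nonempty_Icc.2 hst

theorem chains_empty : chains ∅ = ∅ := by
  refine eq_empty_of_forall_notMem fun χ h => ?_
  obtain ⟨h1, h2⟩ := (mem_chains.1 h).prop
  exact h2.nonempty.ne_empty (subset_empty.1 h1)

theorem run_subset_union {m l : ℕ} {π ρ : Finset ℕ} (hπ : ∀ x ∈ π, x < m) (hρ : IsRun ρ)
    (h : ρ ⊆ π ∪ Icc (m + 1) (m + l)) : ρ ⊆ π ∨ ρ ⊆ Icc (m + 1) (m + l) := by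
  obtain ⟨s, t, hst, rfl⟩ := hρ
  have hm : m ∉ Icc s t := fun hm => by
    rcases mem_union.1 (h hm) with h' | h'
    · exact absurd (hπ _ h') (lt_irrefl _)
    · rw [mem_Icc] at h'; omega
  have : t < m ∨ m < s := by rw [mem_Icc] at hm; omega
  rcases this with h' | h'
  · refine Or.inl fun x hx => (mem_union.1 (h hx)).resolve_right fun hx' => ?_
    rw [mem_Icc] at hx hx'; omega
  · refine Or.inr fun x hx => (mem_union.1 (h hx)).resolve_left fun hx' => ?_
    have := hπ x hx'
    rw [mem_Icc] at hx; omega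

/-- A run cannot cross the gap at m, so maximality can be tested on each side separately. -/
theorem chains_union_run {m l : ℕ} (hl : l ≠ 0) {π : Finset ℕ} (hπ : ∀ x ∈ π, x < m) :
    chains (π ∪ Icc (m + 1) (m + l)) = insert (Icc (m + 1) (m + l)) (chains π) := by
  have hrun : IsRun (Icc (m + 1) (m + l)) := ⟨_, _, by omega, rfl⟩
  have hdisj : ∀ {ρ : Finset ℕ}, ρ.Nonempty → ρ ⊆ π → ¬ ρ ⊆ Icc (m + 1) (m + l) := by
    rintro ρ ⟨x, hx⟩ h1 h2
    have := hπ x (h1 hx)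
    have := mem_Icc.1 (h2 hx)
    omega
  ext χ
  rw [mem_insert, mem_chains, mem_chains]
  constructor
  · intro h
    rcases run_subset_union hπ h.prop.2 h.prop.1 with h' | h'
    · refine Or.inr ⟨⟨h', h.prop.2⟩, fun ρ hρ hle => ?_⟩
      exact h.2 ⟨hρ.1.trans subset_union_left, hρ.2⟩ hle
    · exact Or.inl (le_antisymm h' (h.2 ⟨subset_union_right, hrun⟩ h'))
  · rintro (rfl | h)
    · refine ⟨⟨subset_union_right, hrun⟩, fun ρ hρ hle => ?_⟩
      refine (run_subset_union hπ hρ.2 hρ.1).resolve_left fun h' => ?_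
      exact hdisj hrun.nonempty (hle.trans h') subset_rfl
    · refine ⟨⟨h.prop.1.trans subset_union_left, h.prop.2⟩, fun ρ hρ hle => ?_⟩
      rcases run_subset_union hπ hρ.2 hρ.1 with h' | h'
      · exact h.2 ⟨h', hρ.2⟩ hle
      · exact absurd (hle.trans h') (hdisj h.prop.2.nonempty h.prop.1)

theorem weight_union_run (A B C : R) {m l : ℕ} (hl : l ≠ 0) {π : Finset ℕ}
    (hπ : ∀ x ∈ π, x < m) :
    weight A B C (π ∪ Icc (m + 1) (m + l)) = weight A B C π * runSum A B C m l 6 := by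
  unfold weight
  rw [chains_union_run hl hπ, prod_insert, chainWeight_run A B C m hl, mul_comm]
  intro h
  have h1 := (mem_chains.1 h).prop.1 (mem_Icc.2 (by omega) : m + 1 ∈ Icc (m + 1) (m + l))
  have := hπ _ h1
  omega

/-- The topmost chain of a nonempty set of positive integers. -/
theorem exists_top_run {π : Finset ℕ} (h0 : 0 ∉ π) (hne : π.Nonempty) :
    ∃ (m l : ℕ) (ρ : Finset ℕ), l ≠ 0 ∧ (∀ x ∈ ρ, x < m) ∧ π = ρ ∪ Icc (m + 1) (m + l) := by
  classical
  set t := π.max' hne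
  have ht : t ∈ π := max'_mem _ _
  -- Descending from the maximum, the first missing integer t - d is the gap m below the top chain;
  -- 0 guarantees that one exists.
  have hgap : ∃ d, t - d ∉ π := ⟨t, by simpa using h0⟩
  set d := Nat.find hgap
  have hd : t - d ∉ π := Nat.find_spec hgap
  have hd' : ∀ e < d, t - e ∈ π := fun e he => not_not.1 (Nat.find_min hgap he)
  have hd0 : d ≠ 0 := fun h => hd (by simpa [h] using ht)
  have hdt : d ≤ t := by
    by_contra! h
    exact h0 (by simpa using hd' t h)
  refine ⟨t - d, d, π.filter (· < t - d), hd0, fun x hx => (mem_filter.1 hx).2, ?_⟩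
  ext x
  simp only [mem_union, mem_filter, mem_Icc]
  constructor
  · intro hx
    have h1 : x ≤ t := le_max' _ _ hx
    have h2 : x ≠ t - d := fun h => hd (h ▸ hx)
    by_cases h3 : x < t - d
    · exact Or.inl ⟨hx, h3⟩
    · right; omega
  · rintro (h | h)
    · exact h.1
    · have := hd' (t - x) (by omega)
      rwa [show t - (t - x) = x by omega] at this

theorem weight_eq_colourSum (A B C : R) {π : Finset ℕ} (h0 : 0 ∉ π) :
    weight A B C π = colourSum A B C π := by
  induction π using Finset.strongInduction with
  | H π ih =>
    rcases π.eq_empty_or_nonempty with rfl | hne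
    · rw [colourSum_empty, weight, chains_empty, prod_empty]
    · obtain ⟨m, l, ρ, hl, hρ, rfl⟩ := exists_top_run h0 hne
      rw [weight_union_run A B C hl hρ, colourSum_union_run A B C hρ, ih]
      · refine (ssubset_iff_of_subset subset_union_left).2
          ⟨m + 1, mem_union_right _ (mem_Icc.2 (by omega)), fun h => ?_⟩
        have := hρ _ h
        omega
      · exact fun h => h0 (mem_union_left _ h)

end Chains

/-! ### Generating function of Type-1 partitions and its recurrence -/

section GeneratingFunction

variable {K : Type*} [Field K] (q A B C : K)

/-- The generating function of the Type-1 partitions into parts `≤ n` in which the colour of `n`,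
if `n` is a part, has rank less than `r`. -/
def genFun (n r : ℕ) : K :=
  ∑ π ∈ distinctParts n, rankSum A B C n π r * q ^ (∑ x ∈ π, x)

/-- The generating function of the Type-1 partitions into parts `< n`; it is `0` for `n = 0`. -/
def genFunBelow : ℕ → K
  | 0 => 0
  | n + 1 => genFun q A B C n 6

theorem genFun_zero (r : ℕ) : genFun q A B C 0 r = 1 := by
  have : distinctParts 0 = {∅} := rfl
  rw [genFun, this, sum_singleton, rankSum_of_notMem _ _ _ (notMem_empty _), colourSum_empty]
  simp

theorem genFun_succ (n r : ℕ) : genFun q A B C (n + 1) r =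
    genFun q A B C n 6 + q ^ (n + 1) * transfer A B C n (genFun q A B C n) r := by
  classical
  have hI : Icc 1 (n + 1) = insert (n + 1) (Icc 1 n) := by
    ext x; simp only [mem_Icc, mem_insert]; omega
  have hn : n + 1 ∉ Icc 1 n := by simp
  have hle : ∀ π ∈ (Icc 1 n).powerset, ∀ x ∈ π, x ≤ n := fun π hπ x hx =>
    (mem_Icc.1 (mem_powerset.1 hπ hx)).2
  have hmem : ∀ π ∈ (Icc 1 n).powerset, n + 1 ∉ π := fun π hπ h => by
    have := hle π hπ _ h; omega
  rw [genFun, distinctParts, hI, sum_powerset_insert hn]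
  congr 1
  · refine sum_congr rfl fun π hπ => ?_
    rw [rankSum_of_notMem _ _ _ (hmem π hπ), rankSum_six]
  · rw [transfer, mul_sum]
    calc _ = ∑ π ∈ (Icc 1 n).powerset, ∑ X : Colour, q ^ (n + 1) *
          (if X.rank < r ∧ (n = 0 → X.IsPrimary) then
            X.wt A B C * (rankSum A B C n π X.cut * q ^ (∑ x ∈ π, x)) else 0) := by
          refine sum_congr rfl fun π hπ => ?_
          rw [rankSum_insert _ _ _ (hle π hπ), sum_insert (hmem π hπ), sum_mul]
          refine sum_congr rfl fun X _ => ?_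
          split_ifs
          · ring
          · simp
      _ = _ := by
          rw [sum_comm]
          refine sum_congr rfl fun X _ => ?_
          rw [← mul_sum]
          congr 1
          split_ifs
          · rw [← mul_sum]; rfl
          · simp

theorem genFun_six (n : ℕ) : genFun q A B C n 6 =
    ∑ π ∈ distinctParts n, colourSum A B C π * q ^ (∑ x ∈ π, x) := by
  simp only [genFun, rankSum_six]

theorem genFun_succ_five (n : ℕ) : genFun q A B C (n + 1) 5 =
    genFun q A B C (n + 1) 6 - q ^ (n + 1) * C * genFun q A B C n 6 := by
  rw [genFun_succ, genFun_succ]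
  rcases n with _ | n
  · obtain ⟨-, -, -, -, -, h5, h6⟩ := transfer_zero A B C (genFun q A B C 0)
    rw [h5, h6]; ring
  · obtain ⟨-, -, -, -, -, -, h6⟩ :=
      transfer_of_pos A B C (Nat.succ_ne_zero n) (genFun q A B C (n + 1))
    rw [h6]; ring

theorem genFun_succ_rank_zero (n : ℕ) : genFun q A B C (n + 1) 0 = genFun q A B C n 6 := by
  rw [genFun_succ]
  rcases n with _ | n
  · rw [(transfer_zero A B C _).1]; ring
  · rw [(transfer_of_pos A B C (Nat.succ_ne_zero n) _).1]; ring

/-- Below a part n + 1 of colour AB, n cannot be a part. For n = 0 the colour AB is itself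
forbidden, which is why `genFunBelow` starts with 0. -/
theorem genFun_succ_one (n : ℕ) : genFun q A B C (n + 1) 1 =
    genFun q A B C n 6 + q ^ (n + 1) * (A * B) * genFunBelow q A B C n := by
  rw [genFun_succ]
  rcases n with _ | n
  · rw [(transfer_zero A B C _).2.1, genFunBelow]; ring
  · rw [(transfer_of_pos A B C (Nat.succ_ne_zero n) _).2.1, genFun_succ_rank_zero, genFunBelow]
    ring

theorem genFun_one : genFun q A B C 1 6 = 1 + (A + B + C) * q := by
  rw [genFun_succ, (transfer_zero A B C _).2.2.2.2.2.2]
  simp only [genFun_zero]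
  ring

theorem genFun_two : genFun q A B C 2 6 =
    1 + (A + B + C) * q + (A + B + C) * (1 + (A + B + C) * q) * q ^ 2
      + (A * B + A * C + B * C) * (q ^ 2 - q ^ 3) + A * B * C * q ^ 3 := by
  obtain ⟨-, h1, h2, h3, h4, h5, h6⟩ := transfer_of_pos A B C one_ne_zero (genFun q A B C 1)
  obtain ⟨k0, k1, -, k3, -, k5, k6⟩ := transfer_zero A B C (genFun q A B C 0)
  rw [genFun_succ, h6, h5, h4, h3, h2, h1]
  simp only [genFun_succ q A B C 0, k0, k1, k3, k5, k6, genFun_zero]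
  ring

/-- Bounds 1 and 5 are expressed directly through the unrestricted function, bound 2 through bound
1; the work lies in eliminating bound 3. -/
theorem genFun_recurrence (n : ℕ) : genFun q A B C (n + 3) 6 =
    genFun q A B C (n + 2) 6 + q ^ (n + 3) * (A + B + C) * genFun q A B C (n + 2) 6
      + q ^ (n + 3) * (1 - q ^ (n + 2)) * (A * B + A * C + B * C) * genFun q A B C (n + 1) 6
      + q ^ (3 * n + 6) * (A * B * C) * genFun q A B C n 6
      + q ^ (2 * n + 5) * (A * B * C) * (A + B + C) * genFun q A B C n 6
      + q ^ (3 * n + 6) * (A * B * C) ^ 2 * genFunBelow q A B C n := by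
  have step : ∀ m, _ := fun m =>
    transfer_of_pos A B C (Nat.succ_ne_zero m) (genFun q A B C (m + 1))
  have s := fun m r => genFun_succ q A B C m r
  obtain ⟨-, h1, h2, h3, h4, h5, h6⟩ := step (n + 1)
  obtain ⟨-, k1, k2, k3, k4, k5, k6⟩ := step n
  simp only [Nat.succ_eq_add_one, add_assoc, one_add_one_eq_two] at *
  have a2 := s (n + 2) 2
  have a3 := s (n + 2) 3
  have a4 := s (n + 2) 4
  have a5 := s (n + 2) 5
  have a6 := s (n + 2) 6
  have b2 := s (n + 1) 2
  have b3 := s (n + 1) 3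
  have b4 := s (n + 1) 4
  have b5 := s (n + 1) 5
  have b1 := genFun_succ_one q A B C (n + 1)
  have a1 := genFun_succ_one q A B C (n + 2)
  have c1 := genFun_succ_one q A B C n
  have d5 := genFun_succ_five q A B C (n + 1)
  have c5 := genFun_succ_five q A B C n
  have e1 := s (n + 2) 1
  have f1 := s (n + 1) 1
  simp only [genFunBelow, add_assoc, one_add_one_eq_two, Nat.reduceAdd] at *
  have r2 : genFun q A B C (n + 3) 2 =
      genFun q A B C (n + 3) 1 + q ^ (n + 3) * (A * C * genFun q A B C (n + 2) 1) := by
    rw [a2, e1, h2]; ring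
  have r3 : genFun q A B C (n + 3) 3 =
      genFun q A B C (n + 3) 2 + q ^ (n + 3) * (A * genFun q A B C (n + 2) 3) := by
    rw [a3, a2, h3]; ring
  have r6 : genFun q A B C (n + 3) 6 = genFun q A B C (n + 3) 3 + q ^ (n + 3) *
      (B * C * genFun q A B C (n + 2) 3 + B * genFun q A B C (n + 2) 5
        + C * genFun q A B C (n + 2) 6) := by
    rw [a6, a3, h6, h5, h4]; ring
  have t2 : genFun q A B C (n + 2) 2 =
      genFun q A B C (n + 2) 1 + q ^ (n + 2) * (A * C * genFun q A B C (n + 1) 1) := by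
    rw [b2, f1, k2]; ring
  have t3 : genFun q A B C (n + 2) 3 =
      genFun q A B C (n + 2) 2 + q ^ (n + 2) * (A * genFun q A B C (n + 1) 3) := by
    rw [b3, b2, k3]; ring
  have t5 : genFun q A B C (n + 2) 5 = genFun q A B C (n + 2) 3 + q ^ (n + 2) *
      (B * C * genFun q A B C (n + 1) 3 + B * genFun q A B C (n + 1) 5) := by
    rw [b5, b3, k5, k4]; ring
  rw [a1] at r2
  rw [b1] at r2 t2
  rw [c1] at t2
  rw [c5, d5] at t5
  rw [d5] at r6
  clear a1 a2 a3 a4 a5 a6 b1 b2 b3 b4 b5 c1 c5 d5 e1 f1 h1 h2 h3 h4 h5 h6 k1 k2 k3 k4 k5 k6 s step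
  have z1 : q ^ (n + 1) = q ^ n * q := pow_succ q n
  have z2 : q ^ (n + 2) = q ^ n * q ^ 2 := pow_add q n 2
  have z3 : q ^ (n + 3) = q ^ n * q ^ 3 := pow_add q n 3
  have z4 : q ^ (3 * n + 6) = (q ^ n) ^ 3 * q ^ 6 := by ring
  have z5 : q ^ (2 * n + 5) = (q ^ n) ^ 2 * q ^ 5 := by ring
  simp only [z1, z2, z3, z4, z5] at *
  -- Bound 3 at n + 2 occurs with factor A + BC. Its BC part is expanded by `t3`, its A part is
  -- traded for bound 5 by `t5`, and the resulting multiples of ABC times bound 3 at n + 1 cancel.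
  linear_combination r6 + r3 + r2 + q ^ n * q ^ 3 * (B * C * t3 + B * C * t2 - A * t5)

theorem genFun_eq_rhsSum {q : K} (h0 : q ≠ 0) (hq : ∀ n : ℕ, 0 < n → q ^ n ≠ 1) (n : ℕ) :
    genFun q A B C n 6 = rhsSum q A B C n := by
  induction n using Nat.strong_induction_on with
  | _ n ih =>
    match n, ih with
    | 0, _ => rw [genFun_zero, Nat.cast_zero, rhsSum_zero]
    | 1, _ => rw [genFun_one, Nat.cast_one, rhsSum_one hq]
    | 2, _ => rw [genFun_two, Nat.cast_two, rhsSum_two hq]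
    | n + 3, ih =>
      -- For n = 0 this matches the two zero conventions at L = -1.
      have hb : genFunBelow q A B C n = rhsSum q A B C ((n : ℤ) - 1) := by
        rcases n with _ | n
        · rw [rhsSum_of_neg _ _ _ _ (by simp)]; rfl
        · rw [genFunBelow, ih n (by omega)]; simp
      have e1 : q ^ ((n + 3 : ℕ) : ℤ) = q ^ (n + 3) := zpow_natCast ..
      have e2 : q ^ ((n + 3 : ℕ) - 1 : ℤ) = q ^ (n + 2) := by
        rw [← zpow_natCast]; congr 1; push_cast; ring
      have e3 : q ^ (3 * (n + 3 : ℕ) - 3 : ℤ) = q ^ (3 * n + 6) := by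
        rw [← zpow_natCast]; congr 1; push_cast; ring
      have e4 : q ^ (2 * (n + 3 : ℕ) - 1 : ℤ) = q ^ (2 * n + 5) := by
        rw [← zpow_natCast]; congr 1; push_cast; ring
      rw [genFun_recurrence, rhsSum_recurrence h0 hq A B C (by omega), e1, e2, e3, e4, hb,
        ih (n + 2) (by omega), ih (n + 1) (by omega), ih n (by omega),
        show ((n + 3 : ℕ) - 1 : ℤ) = (n + 2 : ℕ) by push_cast; ring,
        show ((n + 3 : ℕ) - 2 : ℤ) = (n + 1 : ℕ) by push_cast; ring,
        show ((n + 3 : ℕ) - 3 : ℤ) = n by push_cast; ring,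
        show ((n + 3 : ℕ) - 4 : ℤ) = n - 1 by push_cast; ring]

/-- At `q = 0` only the empty partition contributes. -/
theorem sum_colourSum_zero (L : ℕ) :
    ∑ π ∈ distinctParts L, colourSum A B C π * (0 : K) ^ (∑ x ∈ π, x) = 1 := by
  rw [sum_eq_single ∅]
  · simp [colourSum_empty]
  · intro π hπ hne
    obtain ⟨x, hx⟩ := nonempty_iff_ne_empty.2 hne
    have h1 := (mem_Icc.1 (mem_powerset.1 hπ hx)).1
    have h2 : x ≤ ∑ x ∈ π, x := single_le_sum (f := fun x : ℕ => x) (fun _ _ => zero_le) hx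
    rw [zero_pow (by omega), mul_zero]
  · intro h
    exact absurd (empty_mem_powerset _) h

/-- At `q = 0` only the term with `i = j = k = 0` contributes. -/
theorem sum_rhsTerm_zero (L : ℕ) :
    ∑ i ∈ range (L + 1), ∑ j ∈ range (L + 1), ∑ k ∈ range (L + 1),
      rhsTerm (0 : K) A B C L i j k = 1 := by
  have hT : ∀ n : ℕ, n ≠ 0 → T n ≠ 0 := by
    intro n hn
    have : 2 ≤ n * (n + 1) := Nat.mul_le_mul (Nat.one_le_iff_ne_zero.2 hn) (by omega : 2 ≤ n + 1)
    unfold T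
    omega
  have h : ∀ i j k : ℕ, i ≠ 0 ∨ j ≠ 0 ∨ k ≠ 0 → rhsTerm (0 : K) A B C L i j k = 0 := by
    intro i j k h
    have : T i + T j + T k ≠ 0 := by
      rcases h with h | h | h <;> have := hT _ h <;> omega
    rw [rhsTerm, zero_pow this]
    ring
  rw [sum_eq_single 0, sum_eq_single 0, sum_eq_single 0]
  · simp [rhsTerm, qBinom, qPoch, T]
  · exact fun k _ hk => h _ _ _ (by simp [hk])
  · simp
  · exact fun j _ hj => sum_eq_zero fun k _ => h _ _ _ (by simp [hj])
  · simp
  · exact fun i _ hi => sum_eq_zero fun j _ => sum_eq_zero fun k _ => h _ _ _ (by simp [hi])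
  · simp

end GeneratingFunction

end Goellnitz

end

theorem theorem4 {K : Type*} [Field K] (q A B C : K)
    (hq : ∀ n : ℕ, 0 < n → q ^ n ≠ 1) (L : ℕ) :
    (∀ π ∈ Goellnitz.distinctParts L,
      Goellnitz.weight A B C π = Goellnitz.colourSum A B C π) ∧
    ∑ π ∈ Goellnitz.distinctParts L, Goellnitz.weight A B C π * q ^ (∑ x ∈ π, x) =
      ∑ i ∈ Finset.range (L + 1), ∑ j ∈ Finset.range (L + 1), ∑ k ∈ Finset.range (L + 1),
        Goellnitz.rhsTerm q A B C L i j k := by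
  have hw : ∀ π ∈ Goellnitz.distinctParts L,
      Goellnitz.weight A B C π = Goellnitz.colourSum A B C π := fun π hπ =>
    Goellnitz.weight_eq_colourSum A B C fun h0 => by
      simpa using Finset.mem_powerset.1 hπ h0
  refine ⟨hw, ?_⟩
  rw [Finset.sum_congr rfl fun π hπ => by rw [hw π hπ]]
  -- The value q = 0 satisfies `hq`, but the coefficient recurrence uses negative powers of q.
  by_cases h0 : q = 0
  · subst h0
    rw [Goellnitz.sum_colourSum_zero, Goellnitz.sum_rhsTerm_zero]
  · rw [← Goellnitz.genFun_six, Goellnitz.genFun_eq_rhsSum A B C h0 hq,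
      Goellnitz.rhsSum_natCast]
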